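/- Let $m>0$, $F=1-2mR$, and consider the exterior of the Schwarzschild black hole of mass $m$ with coordinates $u=t-r_*$, $R=1/r$, $\omega\in S^2$, where $r_*=r+2m\log(r-2m)$, with the rescaled metric $\hat g=R^2F\,du^2-2\,du\,dR-d\omega^2$ extended to future null infinity $\{R=0\}$. For $u_0<0$ put $\Omega^+_{u_0}=\{u\le u_0,\ 0\le t\le+\infty\}$ (the points with $t=+\infty$ being those with $R=0$), $\mathcal H_s=\{u=-sr_*,\ u\le u_0\}$ for $0<s\le 1$, $\mathcal H_0=\{R=0,\ u\le u_0\}$, and let $\mathcal S^{s,1}_{u_0}$ be the part of $\{u=u_0\}$ between $\mathcal H_s$ and $\mathcal H_1$. Use the tetrad $\hat l=-\sqrt{F/2}\,\partial_R$, $\hat n=\sqrt{2/F}\,(\partial_u+\tfrac12R^2F\,\partial_R)$, $\hat m=\tfrac1{\sqrt2}(\partial_\theta+\tfrac{i}{\sin\theta}\partial_\varphi)$. For a rescaled Maxwell spinor field $\hat\phi_{AB}$ with components $\hat\phi_0,\hat\phi_1,\hat\phi_2$ in the associated spin-frame, let $T=u^2\partial_u-2(1+uR)\partial_R$ be the Morawetz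 vector field, $V^a=T_b\,\hat\phi^{AB}\bar{\hat\phi}{}^{A'B'}$ (where $T_b=T_{BB'}$), and let $\mathcal E_{\mathcal H_s}$ and $\mathcal E_{\mathcal S^{s,1}_{u_0}}$ be the integrals of the $3$-form $V\lrcorner\,\mathrm{dVol}^4$, $\mathrm{dVol}^4=-du\wedge dR\wedge d^2\omega$. Explicitly, for $0<s\le1$, $$\mathcal E_{\mathcal H_s}=\int_{\mathcal H_s}\Big(\big(\tfrac2s-1\big)R^2\big(2+2uR+\tfrac{(uR)^2F}{2}\big)|\hat\phi_0|^2+\big(2+2uR+\tfrac{(uR)^2F}{s}\big)|\hat\phi_1|^2+\tfrac F2u^2|\hat\phi_2|^2\Big)\,du\,d^2\omega,$$ $$\mathcal E_{\mathcal H_0}=\int_{\mathcal H_0}\big(2|\hat\phi_1|^2+\tfrac{u^2}{2}|\hat\phi_2|^2\big)\,du\,d^2\omega,\qquad \mathcal E_{\mathcal S^{s,1}_{u_0}}=\int_{\mathcal S^{s,1}_{u_0}}\Big(\tfrac2F\big(2+2uR+\tfrac{(uR)^2F}{2}\big)|\hat\phi_0|^2+u^2|\hat\phi_1|^2\Big)\,dR\,d^2\omega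 .$$ For every $u_0<0$ with $|u_0|$ large enough (depending on $m$) there is a constant $C>0$ such that, for every smooth solution $\hat\phi_{AB}$ on $\Omega^+_{u_0}$ (smooth up to the boundary, including null infinity) of the rescaled Maxwell equations $\hat\nabla^{AA'}\hat\phi_{AB}=0$ whose data on $\mathcal H_1$ (which then satisfy the constraints) are supported away from $i^0$, i.e. vanish for $u$ close to $-\infty$, and for every $0\le s<1$, the energies below are finite and $$\mathcal E_{\mathcal H_s}(\hat\phi_{AB})\le C\,\mathcal E_{\mathcal H_1}(\hat\phi_{AB}),\qquad \mathcal E_{\mathcal H_1}(\hat\phi_{AB})\le C\big(\mathcal E_{\mathcal H_s}(\hat\phi_{AB})+\mathcal E_{\mathcal S^{s,1}_{u_0}}(\hat\phi_{AB})\big).$$ -/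

import Mathlib

open Set MeasureTheory
open scoped ContDiff Manifold

namespace MaxwellPeeling

noncomputable section

/-! Geometry: the exterior of the Schwarzschild black hole of mass `m`, with the coordinates
`u = t - r_*`, `R = 1/r`, `ω ∈ S²`, and the metric `R² F du² - 2 du dR - dω²`. -/

/-- `F = 1 - 2 m R`. -/
def lapse (m R : ℝ) : ℝ := 1 - 2 * m * R

/-- The Regge-Wheeler coordinate `r_* = r + 2 m log (r - 2 m)`, for `r > 2 m`. -/
def tortoise (m r : ℝ) : ℝ := r + 2 * m * Real.log (r - 2 * m)

/-- `r ↦ r_*` is a bijection from `]2m, +∞[` onto `ℝ`. -/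
theorem tortoise_bijOn {m : ℝ} (hm : 0 < m) : BijOn (tortoise m) (Ioi (2 * m)) univ := by
  have hmono : StrictMonoOn (tortoise m) (Ioi (2 * m)) := by
    intro a ha b _ hab
    have ha' : 0 < a - 2 * m := sub_pos.2 ha
    have hlog : Real.log (a - 2 * m) < Real.log (b - 2 * m) :=
      Real.log_lt_log ha' (by linarith)
    have := mul_lt_mul_of_pos_left hlog (by linarith : 0 < 2 * m)
    simp only [tortoise]
    linarith
  have hcont : ContinuousOn (tortoise m) (Ioi (2 * m)) := by
    unfold tortoise
    refine continuousOn_id.add (continuousOn_const.mul (ContinuousOn.log (by fun_prop) ?_))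
    intro x hx
    exact (sub_pos.2 hx).ne'
  refine ⟨fun _ _ => mem_univ _, hmono.injOn, ?_⟩
  intro y _
  -- below `y` the logarithm dominates, above `y` the identity dominates
  set d : ℝ := min 1 (Real.exp ((y - 2 * m - 1) / (2 * m))) with hd
  have hd0 : 0 < d := lt_min one_pos (Real.exp_pos _)
  have hlow : tortoise m (2 * m + d) ≤ y := by
    have h1 : d ≤ 1 := min_le_left _ _
    have h2 : Real.log d ≤ (y - 2 * m - 1) / (2 * m) := by
      have := Real.log_le_log hd0 (min_le_right 1 (Real.exp ((y - 2 * m - 1) / (2 * m))))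
      rwa [Real.log_exp] at this
    have h3 : 2 * m * Real.log d ≤ y - 2 * m - 1 := by
      rw [le_div_iff₀ (by linarith)] at h2
      linarith
    simp only [tortoise, add_sub_cancel_left]
    linarith
  set b : ℝ := 2 * m + 1 + |y| with hb
  have hhigh : y ≤ tortoise m b := by
    have h1 : 0 ≤ Real.log (b - 2 * m) :=
      Real.log_nonneg (by have := abs_nonneg y; rw [hb]; linarith)
    have h2 := le_abs_self y
    have h3 : 0 ≤ 2 * m * Real.log (b - 2 * m) := by positivity
    simp only [tortoise]
    linarith
  have hle : 2 * m + d ≤ b := by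
    have h1 : d ≤ 1 := min_le_left _ _
    have := abs_nonneg y
    linarith
  have hsub : Icc (2 * m + d) b ⊆ Ioi (2 * m) := fun x hx =>
    lt_of_lt_of_le (by linarith) hx.1
  obtain ⟨x, hx, hxy⟩ := intermediate_value_Icc hle (hcont.mono hsub) ⟨hlow, hhigh⟩
  exact ⟨x, hsub hx, hxy⟩

/-- The radius `r > 2 m` at which `r_*` takes the value `x`. -/
def radius (m x : ℝ) : ℝ := Function.invFunOn (tortoise m) (Ioi (2 * m)) x

/-- The domain `Ω⁺_{u₀} = {u ≤ u₀, 0 ≤ t ≤ +∞}` in the variables `(u, R)`; the points with `R = 0`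
(that is, `t = +∞`) are those of future null infinity. -/
def domain (m u₀ : ℝ) : Set (ℝ × ℝ) :=
  {q | q.1 ≤ u₀ ∧ (q.2 = 0 ∨ (0 < q.2 ∧ 2 * m * q.2 < 1 ∧ 0 ≤ q.1 + tortoise m (1 / q.2)))}

/-- The interior of `domain m u₀`. -/
def domainInterior (m u₀ : ℝ) : Set (ℝ × ℝ) :=
  {q | q.1 < u₀ ∧ 0 < q.2 ∧ 2 * m * q.2 < 1 ∧ 0 < q.1 + tortoise m (1 / q.2)}

/-- The value of `R` at retarded time `u` on the hypersurface `H_s = {u = - s r_*}`; for `s = 0`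
this hypersurface is null infinity, `R = 0`. -/
def hypR (m s u : ℝ) : ℝ := if s = 0 then 0 else 1 / radius m (-u / s)

/-! Fields. -/

/-- Euclidean three-space, in which the unit sphere lies. -/
abbrev E3 : Type := EuclideanSpace ℝ (Fin 3)

/-- The unit sphere `S²`. -/
abbrev S2 : Type := Metric.sphere (0 : E3) 1

instance factFinrankE3 : Fact (Module.finrank ℝ E3 = 2 + 1) := ⟨by simp⟩

/-- The ambient space of the tangent vectors `(X^u, X^R, X^ω)`, where `X^ω ∈ T_ω S² ⊆ ℝ³`. -/
abbrev Vec : Type := ℝ × ℝ × E3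

/-- Real bilinear forms on tangent vectors, at each point `(u, R, ω)`. Only the values on vectors
that are tangent to `ℝ × ℝ × S²` are ever used. -/
abbrev BilinField : Type := ℝ × ℝ × S2 → (Vec →L[ℝ] Vec →L[ℝ] ℝ)

/-- The point of `S²` with polar angle `θ` and azimuth `φ`. -/
def spherePt (θ φ : ℝ) : S2 :=
  ⟨!₂[Real.sin θ * Real.cos φ, Real.sin θ * Real.sin φ, Real.cos θ], by
    rw [mem_sphere_zero_iff_norm, EuclideanSpace.norm_eq, Real.sqrt_eq_one]
    simp only [Fin.sum_univ_three, Real.norm_eq_abs, sq_abs]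
    simp
    nlinarith [Real.sin_sq_add_cos_sq θ, Real.sin_sq_add_cos_sq φ]⟩

/-- `∂_θ`, as a vector of `ℝ³`. -/
def eTheta (θ φ : ℝ) : E3 :=
  !₂[Real.cos θ * Real.cos φ, Real.cos θ * Real.sin φ, -Real.sin θ]

/-- `(1 / sin θ) ∂_φ`, as a vector of `ℝ³`. -/
def ePhi (φ : ℝ) : E3 := !₂[-Real.sin φ, Real.cos φ, 0]

/-- The value of a real bilinear form on the complex vectors `X.1 + i X.2` and `Y.1 + i Y.2`. -/
def cval (B : Vec →L[ℝ] Vec →L[ℝ] ℝ) (X Y : Vec × Vec) : ℂ :=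
  ⟨B X.1 Y.1 - B X.2 Y.2, B X.1 Y.2 + B X.2 Y.1⟩

/-- The tetrad vector `l = - √(F/2) ∂_R` (as a complex vector with zero imaginary part). -/
def tetL (m R : ℝ) : Vec × Vec := ((0, -√(lapse m R / 2), 0), 0)

/-- The tetrad vector `n = √(2/F) (∂_u + (R² F / 2) ∂_R)`. -/
def tetN (m R : ℝ) : Vec × Vec :=
  ((√(2 / lapse m R), √(2 / lapse m R) * (R ^ 2 * lapse m R / 2), 0), 0)

/-- The tetrad vector `(∂_θ + (i / sin θ) ∂_φ) / √2`. -/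
def tetM (θ φ : ℝ) : Vec × Vec :=
  ((0, 0, (1 / √2) • eTheta θ φ), (0, 0, (1 / √2) • ePhi φ))

/-- The complex conjugate of `tetM`. -/
def tetMbar (θ φ : ℝ) : Vec × Vec :=
  ((0, 0, (1 / √2) • eTheta θ φ), (0, 0, -(1 / √2) • ePhi φ))

/-- Complex functions of `(u, R, θ, φ)`. -/
abbrev Comp : Type := ℝ → ℝ → ℝ → ℝ → ℂ

/-- `φ₀ = φ_{AB} o^A o^B`, that is `B(l, m)` for the real two-form
`B = φ_{AB} ε_{A'B'} + complex conjugate`. -/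
def phi0 (m : ℝ) (B : BilinField) : Comp := fun u R θ φ =>
  cval (B (u, R, spherePt θ φ)) (tetL m R) (tetM θ φ)

/-- `φ₁ = φ_{AB} o^A ι^B`, that is `(B(l, n) + B(m̄, m)) / 2`. -/
def phi1 (m : ℝ) (B : BilinField) : Comp := fun u R θ φ =>
  (cval (B (u, R, spherePt θ φ)) (tetL m R) (tetN m R) +
    cval (B (u, R, spherePt θ φ)) (tetMbar θ φ) (tetM θ φ)) / 2

/-- `φ₂ = φ_{AB} ι^A ι^B`, that is `B(m̄, n)`. -/
def phi2 (m : ℝ) (B : BilinField) : Comp := fun u R θ φ =>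
  cval (B (u, R, spherePt θ φ)) (tetMbar θ φ) (tetN m R)

/-! The partial derivatives. -/

def dU (f : Comp) : Comp := fun u R θ φ => deriv (fun x => f x R θ φ) u
def dR (f : Comp) : Comp := fun u R θ φ => deriv (fun x => f u x θ φ) R
def dTheta (f : Comp) : Comp := fun u R θ φ => deriv (fun x => f u R x φ) θ
def dPhi (f : Comp) : Comp := fun u R θ φ => deriv (fun x => f u R θ x) φ

/-- The derivative along `l`. -/
def opD (m : ℝ) (f : Comp) : Comp := fun u R θ φ =>
  -((√(lapse m R / 2) : ℝ) : ℂ) * dR f u R θ φ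

/-- The derivative along `n`. -/
def opD' (m : ℝ) (f : Comp) : Comp := fun u R θ φ =>
  ((√(2 / lapse m R) : ℝ) : ℂ) *
    (dU f u R θ φ + ((R ^ 2 * lapse m R / 2 : ℝ) : ℂ) * dR f u R θ φ)

/-- The derivative along the tetrad vector `tetM`. -/
def opDelta (f : Comp) : Comp := fun u R θ φ =>
  ((1 / √2 : ℝ) : ℂ) * (dTheta f u R θ φ + Complex.I / (Real.sin θ : ℂ) * dPhi f u R θ φ)

/-- The derivative along the tetrad vector `tetMbar`. -/
def opDelta' (f : Comp) : Comp := fun u R θ φ =>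
  ((1 / √2 : ℝ) : ℂ) * (dTheta f u R θ φ - Complex.I / (Real.sin θ : ℂ) * dPhi f u R θ φ)

/-- The spin coefficient `ε` (`κ, σ, λ, τ, ν, π, ρ, μ` vanish for this tetrad). -/
def spinEps (m R : ℝ) : ℝ := m / (2 * √(2 * lapse m R))

/-- The spin coefficient `γ`. -/
def spinGamma (m R : ℝ) : ℝ := (5 * m * R ^ 2 - 2 * R) / (2 * √(2 * lapse m R))

/-- The spin coefficient `β = - α`. -/
def spinBeta (θ : ℝ) : ℝ := Real.cos θ / Real.sin θ / (2 * √2)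

/-- The field is a real two-form, smooth on `domain m u₀ × S²` up to the boundary, and its spinor
`φ_{AB}` solves the rescaled Maxwell equation `∇^{AA'} φ_{AB} = 0`, which is written out as the four
component equations in the Newman-Penrose tetrad. -/
structure IsMaxwellField (m u₀ : ℝ) (B : BilinField) : Prop where
  skew : ∀ p : ℝ × ℝ × S2, (p.1, p.2.1) ∈ domain m u₀ → ∀ X Y : Vec, B p X Y = -B p Y X
  smooth : ContMDiffOn (𝓘(ℝ, ℝ).prod (𝓘(ℝ, ℝ).prod (𝓡 2))) 𝓘(ℝ, Vec →L[ℝ] Vec →L[ℝ] ℝ) ∞ B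
    {p | (p.1, p.2.1) ∈ domain m u₀}
  eq1 : ∀ u R θ φ : ℝ, (u, R) ∈ domainInterior m u₀ → θ ∈ Ioo 0 Real.pi →
    opD' m (phi0 m B) u R θ φ - opDelta (phi1 m B) u R θ φ
      - 2 * (spinGamma m R : ℂ) * phi0 m B u R θ φ = 0
  eq2 : ∀ u R θ φ : ℝ, (u, R) ∈ domainInterior m u₀ → θ ∈ Ioo 0 Real.pi →
    opD m (phi1 m B) u R θ φ - opDelta' (phi0 m B) u R θ φ
      - 2 * (spinBeta θ : ℂ) * phi0 m B u R θ φ = 0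
  eq3 : ∀ u R θ φ : ℝ, (u, R) ∈ domainInterior m u₀ → θ ∈ Ioo 0 Real.pi →
    opD' m (phi1 m B) u R θ φ - opDelta (phi2 m B) u R θ φ
      - 2 * (spinBeta θ : ℂ) * phi2 m B u R θ φ = 0
  eq4 : ∀ u R θ φ : ℝ, (u, R) ∈ domainInterior m u₀ → θ ∈ Ioo 0 Real.pi →
    opD m (phi2 m B) u R θ φ - opDelta' (phi1 m B) u R θ φ
      + 2 * (spinEps m R : ℂ) * phi2 m B u R θ φ = 0

/-- The restriction of the field to `H₁ = {t = 0, u ≤ u₀}` is supported away from spacelike infinity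
`i⁰`, that is, from the end `u = - r_* → - ∞` of `H₁`. -/
def DataSupportedAwayFromI0 (m u₀ : ℝ) (B : BilinField) : Prop :=
  ∃ L : ℝ, ∀ u ≤ u₀, u < L → ∀ θ ∈ Ioo 0 Real.pi, ∀ φ : ℝ,
    phi0 m B u (hypR m 1 u) θ φ = 0 ∧ phi1 m B u (hypR m 1 u) θ φ = 0 ∧
      phi2 m B u (hypR m 1 u) θ φ = 0

/-! Energies: the Morawetz vector field is `T = u² ∂_u - 2 (1 + u R) ∂_R`, the stress-energy tensor
`φ_{AB} φ̄_{A'B'}`, the current `V^a = T^{ab} T_b`, and the energy on an oriented hypersurface is the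
integral of the contraction of `V` with the volume form `- du ∧ dR ∧ d²ω`. -/

/-- The component of `T` along `l`. -/
def morawetzL (m u R : ℝ) : ℝ :=
  √(2 / lapse m R) * (2 * (1 + u * R) + (u * R) ^ 2 * lapse m R / 2)

/-- The component of `T` along `n`. -/
def morawetzN (m u R : ℝ) : ℝ := u ^ 2 * √(lapse m R / 2)

/-- The component of `V` along `l`. -/
def currentL (m : ℝ) (B : BilinField) (u R θ φ : ℝ) : ℝ :=
  morawetzL m u R * ‖phi1 m B u R θ φ‖ ^ 2 + morawetzN m u R * ‖phi2 m B u R θ φ‖ ^ 2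

/-- The component of `V` along `n`. -/
def currentN (m : ℝ) (B : BilinField) (u R θ φ : ℝ) : ℝ :=
  morawetzL m u R * ‖phi0 m B u R θ φ‖ ^ 2 + morawetzN m u R * ‖phi1 m B u R θ φ‖ ^ 2

/-- `V^u`. -/
def currentU (m : ℝ) (B : BilinField) (u R θ φ : ℝ) : ℝ :=
  √(2 / lapse m R) * currentN m B u R θ φ

/-- `V^R`. -/
def currentR (m : ℝ) (B : BilinField) (u R θ φ : ℝ) : ℝ :=
  -√(lapse m R / 2) * currentL m B u R θ φ
    + √(2 / lapse m R) * (R ^ 2 * lapse m R / 2) * currentN m B u R θ φ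

/-- The angles `(θ, φ)`. -/
def angles : Set (ℝ × ℝ) := Ioo 0 Real.pi ×ˢ Ioo 0 (2 * Real.pi)

/-- The energy density on `H_s` with respect to `du dθ dφ`. On `H_s`, `s > 0`, one has
`dR = (F R² / s) du`, and the density is `sin θ` times
`(2/s - 1) R² (2 + 2uR + (uR)² F/2) |φ₀|² + (2 + 2uR + (uR)² F/s) |φ₁|² + (F/2) u² |φ₂|²`.
On `H_0` one has `R = 0`, `dR = 0`, and it is `sin θ` times `2 |φ₁|² + (u²/2) |φ₂|²`. -/
def densityH (m s : ℝ) (B : BilinField) (x : ℝ × ℝ × ℝ) : ℝ :=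
  (currentU m B x.1 (hypR m s x.1) x.2.1 x.2.2
      * (if s = 0 then 0 else lapse m (hypR m s x.1) * hypR m s x.1 ^ 2 / s)
    - currentR m B x.1 (hypR m s x.1) x.2.1 x.2.2) * Real.sin x.2.1

/-- `H_s`, parametrized by `(u, θ, φ)`. -/
def paramH (u₀ : ℝ) : Set (ℝ × ℝ × ℝ) := Iio u₀ ×ˢ angles

/-- The Morawetz energy on `H_s`. -/
def energyH (m u₀ s : ℝ) (B : BilinField) : ℝ := ∫ x in paramH u₀, densityH m s B x

/-- The energy density on the null hypersurface `S_{u₀}` with respect to `dR dθ dφ`, that is,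
`sin θ` times `(2/F) (2 + 2uR + (uR)² F/2) |φ₀|² + u² |φ₁|²` at `u = u₀`. -/
def densityS (m u₀ : ℝ) (B : BilinField) (x : ℝ × ℝ × ℝ) : ℝ :=
  currentU m B u₀ x.1 x.2.1 x.2.2 * Real.sin x.2.1

/-- The part `S^{s,1}_{u₀}` of `S_{u₀}` between `H_s` and `H_1`, parametrized by `(R, θ, φ)`. -/
def paramS (m u₀ s : ℝ) : Set (ℝ × ℝ × ℝ) := Ioo (hypR m s u₀) (hypR m 1 u₀) ×ˢ angles

/-- The flux through `S^{s,1}_{u₀}`. -/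
def energyS (m u₀ s : ℝ) (B : BilinField) : ℝ := ∫ x in paramS m u₀ s, densityS m u₀ B x

end

end MaxwellPeeling

namespace MaxwellPeeling

/-! The proof applies the divergence theorem to the Morawetz current `V`, on the region between
`H_s` and `{t = 0}` over an interval `[α, u₀]` of retarded times. `T` is not Killing. By the Maxwell
equations the divergence of `V` reduces to `4 m R² F⁻¹ (3 + u R) |φ₀|²`
(`divergence_weightedCurrent`).

Far out, `r_* / r` is close to `1` on `{t = 0}`, so `u R ≥ -5/4` and `F ≥ 3/4` to its future
(`exists_far`). There `2 + 2uR + (uR)² F / 2 ≥ 1/16`, so the energy densities are nonnegative on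
every `H_s` and on `{u = u₀}` (`slope_flux_nonneg`, `fluxU_nonneg`).

The bulk term is nonnegative as well, which gives `E(H_1) ≤ E(H_s) + E(S)` without any loss. The
other estimate is a Gronwall argument carried out with a weight. The bulk term is `O(u⁻²)` times the
`φ₀` part of `V^u`, and `u⁻²` is integrable at `-∞`. For the current multiplied by `exp (160 m / u)`
the divergence is therefore nonpositive (`weightedError_expWeight_nonpos`). On `u ≤ u₀` this weight
lies between its value at `u₀` and `1`, hence a constant that depends neither on `s` nor on the
field.

What remains is the end `u → -∞`, where all the `H_s` run to spacelike infinity or along null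
infinity. The field has to vanish for `u` near `-∞`, not only its data (`component_eq_zero_of_le`).
This is finite speed of propagation. The hypersurface `r_* = c - (3/4) u` through a given point is
spacelike with positive definite energy density, and it meets `{t = 0}` at a finite `u`. The same
weighted estimate, between it and vanishing data, forces the field to vanish at the point. After
that every integral lives on a bounded strip, and `energy_estimates` reads off both inequalities. -/

/-! The divergence theorem on four-dimensional boxes and on regions between two graphs. -/

/-- Integrals over boxes of `Fin 3 → ℝ` as integrals over boxes of `ℝ × ℝ × ℝ`. -/
theorem setIntegral_Icc_fin_three (c d : Fin 3 → ℝ) (G : (Fin 3 → ℝ) → ℝ) :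
    ∫ x in Icc c d, G x =
      ∫ y in Ioo (c 0) (d 0) ×ˢ Ioo (c 1) (d 1) ×ˢ Ioo (c 2) (d 2), G ![y.1, y.2.1, y.2.2] := by
  let e : (Fin 3 → ℝ) ≃ᵐ ℝ × ℝ × ℝ :=
    (MeasurableEquiv.piFinSuccAbove (fun _ : Fin 3 => ℝ) 0).trans
      (MeasurableEquiv.prodCongr (MeasurableEquiv.refl ℝ) MeasurableEquiv.finTwoArrow)
  have he : MeasurePreserving e volume volume :=
    ((MeasurePreserving.id volume).prod (volume_preserving_finTwoArrow ℝ)).comp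
      (volume_preserving_piFinSuccAbove (fun _ : Fin 3 => ℝ) 0)
  have hev : ∀ x, e x = (x 0, x 1, x 2) := fun x => rfl
  rw [← he.setIntegral_preimage_emb e.measurableEmbedding, volume_pi,
    ← setIntegral_congr_set (Measure.univ_pi_Ioo_ae_eq_Icc (μ := fun _ => volume) (f := c) (g := d))]
  have hset : e ⁻¹' (Ioo (c 0) (d 0) ×ˢ Ioo (c 1) (d 1) ×ˢ Ioo (c 2) (d 2)) =
      pi univ fun i => Ioo (c i) (d i) := by
    ext x
    simp [hev, Fin.forall_fin_succ]
  rw [hset]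
  congr 1
  ext x
  congr 1
  ext i
  fin_cases i <;> rfl

/-- The divergence theorem on a box of `ℝ⁴`, for fields that vanish on the faces of the third
variable and take the same values on the two faces of the fourth one. -/
theorem integral_divergence_box (a b : Fin 4 → ℝ) (hab : a ≤ b) (X : Fin 4 → (Fin 4 → ℝ) → ℝ)
    (h : (Fin 4 → ℝ) → ℝ) (hc : ∀ i, ContinuousOn (X i) (Icc a b))
    (hh : ContinuousOn h (Icc a b))
    (hd : ∀ x, (∀ i, x i ∈ Ioo (a i) (b i)) → ∀ i, DifferentiableAt ℝ (X i) x)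
    (hdiv : ∀ x, (∀ i, x i ∈ Ioo (a i) (b i)) →
      ∑ i, fderiv ℝ (X i) x (Pi.single i 1) = h x)
    (h2 : ∀ x, x 2 = a 2 ∨ x 2 = b 2 → X 2 x = 0)
    (h3 : ∀ u v t, X 3 ![u, v, t, b 3] = X 3 ![u, v, t, a 3]) :
    ∫ x in Icc a b, h x =
      (∫ y in Ioo (a 1) (b 1) ×ˢ Ioo (a 2) (b 2) ×ˢ Ioo (a 3) (b 3),
          X 0 ![b 0, y.1, y.2.1, y.2.2])
        - (∫ y in Ioo (a 1) (b 1) ×ˢ Ioo (a 2) (b 2) ×ˢ Ioo (a 3) (b 3),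
          X 0 ![a 0, y.1, y.2.1, y.2.2])
        + ((∫ y in Ioo (a 0) (b 0) ×ˢ Ioo (a 2) (b 2) ×ˢ Ioo (a 3) (b 3),
          X 1 ![y.1, b 1, y.2.1, y.2.2])
        - (∫ y in Ioo (a 0) (b 0) ×ˢ Ioo (a 2) (b 2) ×ˢ Ioo (a 3) (b 3),
          X 1 ![y.1, a 1, y.2.1, y.2.2])) := by
  -- The divergence equals the continuous function `h` only in the open box. The faces are null, so
  -- this suffices both for integrability of the divergence and for the value of its integral.
  have hae : (fun x => ∑ i, fderiv ℝ (X i) x (Pi.single i 1))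
      =ᵐ[volume.restrict (Icc a b)] h := by
    rw [volume_pi, ← Measure.restrict_congr_set
      (Measure.univ_pi_Ioo_ae_eq_Icc (μ := fun _ => volume) (f := a) (g := b))]
    refine ae_restrict_of_forall_mem (MeasurableSet.univ_pi fun i => measurableSet_Ioo) ?_
    intro x hx
    exact hdiv x fun i => hx i (mem_univ i)
  have hint : IntegrableOn h (Icc a b) := hh.integrableOn_compact isCompact_Icc
  have key := integral_divergence_of_hasFDerivAt_off_countable' a b hab X
    (fun i x => fderiv ℝ (X i) x) ∅ countable_empty hc
    (fun x hx i => (hd x (fun j => hx.1 j (mem_univ j)) i).hasFDerivAt)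
    (hint.congr hae.symm)
  rw [integral_congr_ae hae] at key
  rw [key, Fin.sum_univ_four]
  simp only [setIntegral_Icc_fin_three, Function.comp]
  have e0 : ∀ (c : ℝ) (y : ℝ × ℝ × ℝ), (Fin.insertNth (0 : Fin 4) c ![y.1, y.2.1, y.2.2] : Fin 4 → ℝ)
      = ![c, y.1, y.2.1, y.2.2] := by
    intro c y; ext i; fin_cases i <;> rfl
  have e1 : ∀ (c : ℝ) (y : ℝ × ℝ × ℝ), (Fin.insertNth (1 : Fin 4) c ![y.1, y.2.1, y.2.2] : Fin 4 → ℝ)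
      = ![y.1, c, y.2.1, y.2.2] := by
    intro c y; ext i; fin_cases i <;> rfl
  have e3 : ∀ (c : ℝ) (y : ℝ × ℝ × ℝ), (Fin.insertNth (3 : Fin 4) c ![y.1, y.2.1, y.2.2] : Fin 4 → ℝ)
      = ![y.1, y.2.1, y.2.2, c] := by
    intro c y; ext i; fin_cases i <;> rfl
  have z2 : ∀ (c : ℝ) (y : ℝ × ℝ × ℝ), c = a 2 ∨ c = b 2 →
      X 2 (Fin.insertNth (2 : Fin 4) c ![y.1, y.2.1, y.2.2] : Fin 4 → ℝ) = 0 := by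
    intro c y hcy
    apply h2
    simpa using hcy
  simp only [e0, e1, e3, h3, z2 (a 2) _ (Or.inl rfl), z2 (b 2) _ (Or.inr rfl), integral_zero,
    sub_self, add_zero]
  rfl

/-! ### Partial derivatives as one-variable derivatives. -/

theorem hasDerivAt_comp_update {E : Type*} [NormedAddCommGroup E] [NormedSpace ℝ E]
    {Y : (Fin 4 → ℝ) → E} {x : Fin 4 → ℝ} (hY : DifferentiableAt ℝ Y x) (i : Fin 4) :
    HasDerivAt (fun t => Y (Function.update x i t)) (fderiv ℝ Y x (Pi.single i 1)) (x i) := by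
  have h := hasDerivAt_update x i (x i)
  have hY' : HasFDerivAt Y (fderiv ℝ Y x) (Function.update x i (x i)) := by
    rw [Function.update_eq_self]; exact hY.hasFDerivAt
  exact hY'.comp_hasDerivAt (x i) h

theorem fderiv_single_eq {E : Type*} [NormedAddCommGroup E] [NormedSpace ℝ E]
    {Y : (Fin 4 → ℝ) → E} {x : Fin 4 → ℝ} (hY : DifferentiableAt ℝ Y x) (i : Fin 4) {y : E}
    (h : HasDerivAt (fun t => Y (Function.update x i t)) y (x i)) :
    fderiv ℝ Y x (Pi.single i 1) = y :=
  (hasDerivAt_comp_update hY i).unique h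

theorem update_zero_vec (x : Fin 4 → ℝ) (t : ℝ) :
    Function.update x 0 t = ![t, x 1, x 2, x 3] := by
  ext i; fin_cases i <;> rfl

theorem update_one_vec (x : Fin 4 → ℝ) (t : ℝ) :
    Function.update x 1 t = ![x 0, t, x 2, x 3] := by
  ext i; fin_cases i <;> rfl

theorem update_two_vec (x : Fin 4 → ℝ) (t : ℝ) :
    Function.update x 2 t = ![x 0, x 1, t, x 3] := by
  ext i; fin_cases i <;> rfl

theorem update_three_vec (x : Fin 4 → ℝ) (t : ℝ) :
    Function.update x 3 t = ![x 0, x 1, x 2, t] := by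
  ext i; fin_cases i <;> rfl

/-! ### The region between two graphs. -/

/-- The parametrization of the region between the graphs of `p` and `q` by a box. -/
def graphMap (p q : ℝ → ℝ) (x : Fin 4 → ℝ) : Fin 4 → ℝ :=
  ![x 0, p (x 0) + x 1 * (q (x 0) - p (x 0)), x 2, x 3]

/-- The closed region between the graphs of `p` and `q`, over `[α, β]`. -/
def graphRegion (p q : ℝ → ℝ) (α β : ℝ) : Set (Fin 4 → ℝ) :=
  {x | x 0 ∈ Icc α β ∧ x 1 ∈ Icc (p (x 0)) (q (x 0)) ∧ x 2 ∈ Icc 0 Real.pi ∧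
    x 3 ∈ Icc 0 (2 * Real.pi)}

/-- The interior of the region between the graphs of `p` and `q`. -/
def graphInterior (p q : ℝ → ℝ) (α β : ℝ) : Set (Fin 4 → ℝ) :=
  {x | x 0 ∈ Ioo α β ∧ x 1 ∈ Ioo (p (x 0)) (q (x 0)) ∧ x 2 ∈ Ioo 0 Real.pi ∧
    x 3 ∈ Ioo 0 (2 * Real.pi)}

/-- The box that parametrizes `graphRegion`. -/
def graphBox (α β : ℝ) : Set (Fin 4 → ℝ) :=
  Icc ![α, 0, 0, 0] ![β, 1, Real.pi, 2 * Real.pi]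

theorem graphMap_mem_graphRegion {p q : ℝ → ℝ} {α β : ℝ}
    (hpq : ∀ u ∈ Icc α β, p u ≤ q u) {x : Fin 4 → ℝ} (hx : x ∈ graphBox α β) :
    graphMap p q x ∈ graphRegion p q α β := by
  simp only [graphBox, mem_Icc, Pi.le_def, Fin.forall_fin_succ] at hx
  simp at hx
  obtain ⟨⟨h1, h2, h3, h4⟩, h5, h6, h7, h8⟩ := hx
  have h := hpq (x 0) ⟨h1, h5⟩
  refine ⟨⟨h1, h5⟩, ⟨?_, ?_⟩, ⟨h3, h7⟩, ⟨h4, h8⟩⟩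
  · change p (x 0) ≤ p (x 0) + x 1 * (q (x 0) - p (x 0))
    nlinarith
  · change p (x 0) + x 1 * (q (x 0) - p (x 0)) ≤ q (x 0)
    nlinarith

/-- The divergence theorem on the region between two graphs. -/
theorem integral_divergence_graph {p q p' q' : ℝ → ℝ} {α β : ℝ} (hαβ : α ≤ β)
    (hp : ∀ u, HasDerivAt p (p' u) u) (hq : ∀ u, HasDerivAt q (q' u) u)
    (hp' : Differentiable ℝ p') (hq' : Differentiable ℝ q')
    (hpq : ∀ u ∈ Icc α β, p u ≤ q u) (hpq' : ∀ u ∈ Ioo α β, p u < q u)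
    (X : Fin 4 → (Fin 4 → ℝ) → ℝ) (h : (Fin 4 → ℝ) → ℝ)
    (hc : ∀ i, ContinuousOn (X i) (graphRegion p q α β))
    (hh : ContinuousOn h (graphRegion p q α β))
    (hd : ∀ x ∈ graphInterior p q α β, ∀ i, DifferentiableAt ℝ (X i) x)
    (hdiv : ∀ x ∈ graphInterior p q α β, ∑ i, fderiv ℝ (X i) x (Pi.single i 1) = h x)
    (h2 : ∀ x, x 2 = 0 ∨ x 2 = Real.pi → X 2 x = 0)
    (h3 : ∀ u v t, X 3 ![u, v, t, 2 * Real.pi] = X 3 ![u, v, t, 0]) :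
    ∫ x in graphBox α β, (q (x 0) - p (x 0)) * h (graphMap p q x) =
      (∫ y in Ioo 0 1 ×ˢ angles,
          (q β - p β) * X 0 ![β, p β + y.1 * (q β - p β), y.2.1, y.2.2])
        - (∫ y in Ioo 0 1 ×ˢ angles,
          (q α - p α) * X 0 ![α, p α + y.1 * (q α - p α), y.2.1, y.2.2])
        + ((∫ y in Ioo α β ×ˢ angles,
          (X 1 ![y.1, q y.1, y.2.1, y.2.2] - q' y.1 * X 0 ![y.1, q y.1, y.2.1, y.2.2]))
        - (∫ y in Ioo α β ×ˢ angles,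
          (X 1 ![y.1, p y.1, y.2.1, y.2.2] - p' y.1 * X 0 ![y.1, p y.1, y.2.1, y.2.2]))) := by
  have hpc : Continuous p := continuous_iff_continuousAt.2 fun u => (hp u).continuousAt
  have hqc : Continuous q := continuous_iff_continuousAt.2 fun u => (hq u).continuousAt
  have hpd : Differentiable ℝ p := fun u => (hp u).differentiableAt
  have hqd : Differentiable ℝ q := fun u => (hq u).differentiableAt
  have hmaps : MapsTo (graphMap p q) (graphBox α β) (graphRegion p q α β) :=
    fun x hx => graphMap_mem_graphRegion hpq hx
  have hΨc : Continuous (graphMap p q) := by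
    refine continuous_pi fun i => ?_
    fin_cases i <;> simp [graphMap] <;> fun_prop
  have hΨd : Differentiable ℝ (graphMap p q) := by
    refine differentiable_pi.2 fun i => ?_
    fin_cases i <;> simp [graphMap] <;> fun_prop
  have hp'c : Continuous p' := hp'.continuous
  have hq'c : Continuous q' := hq'.continuous
  -- The Piola transform of `X` under `graphMap`. The terms `(q' - p') X 0` from the first two
  -- components cancel, as do the terms with `∂₁ (X 0)`, so that the divergence of `Y` is the
  -- Jacobian `q - p` times the divergence of `X` at the image point.
  let Y : Fin 4 → (Fin 4 → ℝ) → ℝ := ![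
    fun x => (q (x 0) - p (x 0)) * X 0 (graphMap p q x),
    fun x => X 1 (graphMap p q x)
      - (p' (x 0) + x 1 * (q' (x 0) - p' (x 0))) * X 0 (graphMap p q x),
    fun x => (q (x 0) - p (x 0)) * X 2 (graphMap p q x),
    fun x => (q (x 0) - p (x 0)) * X 3 (graphMap p q x)]
  have hXc : ∀ i, ContinuousOn (fun x => X i (graphMap p q x)) (graphBox α β) :=
    fun i => (hc i).comp hΨc.continuousOn hmaps
  have hint : ∀ x : Fin 4 → ℝ, (∀ i, x i ∈ Ioo ((![α, 0, 0, 0] : Fin 4 → ℝ) i)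
      ((![β, 1, Real.pi, 2 * Real.pi] : Fin 4 → ℝ) i)) →
      x 0 ∈ Ioo α β ∧ graphMap p q x ∈ graphInterior p q α β := by
    intro x hx
    have a0 : x 0 ∈ Ioo α β := hx 0
    have a1 : x 1 ∈ Ioo (0 : ℝ) 1 := hx 1
    have hlt := hpq' (x 0) a0
    refine ⟨a0, a0, ⟨?_, ?_⟩, hx 2, hx 3⟩
    · change p (x 0) < p (x 0) + x 1 * (q (x 0) - p (x 0))
      nlinarith [a1.1]
    · change p (x 0) + x 1 * (q (x 0) - p (x 0)) < q (x 0)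
      nlinarith [a1.2]
  have hXd : ∀ x : Fin 4 → ℝ, (∀ i, x i ∈ Ioo ((![α, 0, 0, 0] : Fin 4 → ℝ) i)
      ((![β, 1, Real.pi, 2 * Real.pi] : Fin 4 → ℝ) i)) → ∀ i,
      DifferentiableAt ℝ (fun x => X i (graphMap p q x)) x :=
    fun x hx i => (hd _ (hint x hx).2 i).comp x (hΨd x)
  have hYd : ∀ x : Fin 4 → ℝ, (∀ i, x i ∈ Ioo ((![α, 0, 0, 0] : Fin 4 → ℝ) i)
      ((![β, 1, Real.pi, 2 * Real.pi] : Fin 4 → ℝ) i)) → ∀ i,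
      DifferentiableAt ℝ (Y i) x := by
    intro x hx i
    have hl : DifferentiableAt ℝ (fun x : Fin 4 → ℝ => q (x 0) - p (x 0)) x := by fun_prop
    have hr : DifferentiableAt ℝ
      (fun x : Fin 4 → ℝ => p' (x 0) + x 1 * (q' (x 0) - p' (x 0))) x := by fun_prop
    have g := hXd x hx
    fin_cases i
    exacts [hl.mul (g 0), (g 1).sub (hr.mul (g 0)), hl.mul (g 2), hl.mul (g 3)]
  have key := integral_divergence_box ![α, 0, 0, 0] ![β, 1, Real.pi, 2 * Real.pi] ?_ Y
    (fun x => (q (x 0) - p (x 0)) * h (graphMap p q x)) ?_ ?_ hYd ?_ ?_ ?_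
  · rw [graphBox, key]
    simp only [Y, graphMap, angles]
    simp
  · intro i
    fin_cases i
    · exact hαβ
    · exact zero_le_one
    · exact Real.pi_pos.le
    · exact Real.two_pi_pos.le
  · intro i
    have hl : ContinuousOn (fun x : Fin 4 → ℝ => q (x 0) - p (x 0)) (graphBox α β) := by fun_prop
    have hr : ContinuousOn (fun x : Fin 4 → ℝ => p' (x 0) + x 1 * (q' (x 0) - p' (x 0)))
      (graphBox α β) := by fun_prop
    fin_cases i
    exacts [hl.mul (hXc 0), (hXc 1).sub (hr.mul (hXc 0)), hl.mul (hXc 2), hl.mul (hXc 3)]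
  · have := hh.comp hΨc.continuousOn hmaps
    exact ContinuousOn.mul (by fun_prop) this
  · intro x hx
    obtain ⟨-, hΨ⟩ := hint x hx
    have hdX := fun i => hd _ hΨ i
    have hcomp : ∀ (j i : Fin 4) (v : Fin 4 → ℝ),
        HasDerivAt (fun t => graphMap p q (Function.update x i t)) v (x i) →
        HasDerivAt (fun t => X j (graphMap p q (Function.update x i t)))
          (fderiv ℝ (X j) (graphMap p q x) v) (x i) := by
      intro j i v hv
      have : HasFDerivAt (X j) (fderiv ℝ (X j) (graphMap p q x))
          (graphMap p q (Function.update x i (x i))) := by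
        rw [Function.update_eq_self]; exact (hdX j).hasFDerivAt
      exact this.comp_hasDerivAt (x i) hv
    set ru := p' (x 0) + x 1 * (q' (x 0) - p' (x 0)) with hru
    set l := q (x 0) - p (x 0) with hl
    have v0 : HasDerivAt (fun t => graphMap p q (Function.update x 0 t))
        (Pi.single 0 1 + ru • Pi.single 1 1) (x 0) := by
      simp only [update_zero_vec, graphMap]
      refine hasDerivAt_pi.2 fun i => ?_
      fin_cases i
      · simpa using hasDerivAt_id' (x 0)
      · have := (hp (x 0)).add (((hq (x 0)).sub (hp (x 0))).const_mul (x 1))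
        simp only [← hru] at this
        simpa [Pi.add_def] using this
      · simpa using hasDerivAt_const (x 0) (x 2)
      · simpa using hasDerivAt_const (x 0) (x 3)
    have v1 : HasDerivAt (fun t => graphMap p q (Function.update x 1 t))
        (l • Pi.single 1 1) (x 1) := by
      simp only [update_one_vec, graphMap]
      refine hasDerivAt_pi.2 fun i => ?_
      fin_cases i
      · simpa using hasDerivAt_const (x 1) (x 0)
      · simpa using ((hasDerivAt_id (x 1)).mul_const l).const_add (p (x 0))
      · simpa using hasDerivAt_const (x 1) (x 2)
      · simpa using hasDerivAt_const (x 1) (x 3)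
    have v2 : HasDerivAt (fun t => graphMap p q (Function.update x 2 t))
        (Pi.single 2 1) (x 2) := by
      simp only [update_two_vec, graphMap]
      refine hasDerivAt_pi.2 fun i => ?_
      fin_cases i
      · simpa using hasDerivAt_const (x 2) (x 0)
      · simpa using hasDerivAt_const (x 2) (p (x 0) + x 1 * (q (x 0) - p (x 0)))
      · simpa using hasDerivAt_id' (x 2)
      · simpa using hasDerivAt_const (x 2) (x 3)
    have v3 : HasDerivAt (fun t => graphMap p q (Function.update x 3 t))
        (Pi.single 3 1) (x 3) := by
      simp only [update_three_vec, graphMap]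
      refine hasDerivAt_pi.2 fun i => ?_
      fin_cases i
      · simpa using hasDerivAt_const (x 3) (x 0)
      · simpa using hasDerivAt_const (x 3) (p (x 0) + x 1 * (q (x 0) - p (x 0)))
      · simpa using hasDerivAt_const (x 3) (x 2)
      · simpa using hasDerivAt_id' (x 3)
    have d0 := fderiv_single_eq (hYd x hx 0) 0
      (((hq (x 0)).sub (hp (x 0))).mul (hcomp 0 0 _ v0))
    have d1 := fderiv_single_eq (hYd x hx 1) 1
      ((hcomp 1 1 _ v1).sub
        ((((hasDerivAt_id (x 1)).mul_const (q' (x 0) - p' (x 0))).const_add (p' (x 0))).mul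
          (hcomp 0 1 _ v1)))
    have d2 := fderiv_single_eq (hYd x hx 2) 2 ((hcomp 2 2 _ v2).const_mul l)
    have d3 := fderiv_single_eq (hYd x hx 3) 3 ((hcomp 3 3 _ v3).const_mul l)
    rw [Fin.sum_univ_four, d0, d1, d2, d3]
    have := hdiv _ hΨ
    rw [Fin.sum_univ_four] at this
    simp only [Function.update_eq_self, map_add, map_smul, smul_eq_mul, id]
    rw [← this]
    simp only [Pi.sub_apply]
    ring
  · intro x hx
    simp only [Y]
    simp only [Matrix.cons_val]
    rw [h2 _ (by simpa [graphMap] using hx), mul_zero]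
  · intro u v t
    simp only [Y, graphMap]
    simp [h3]

/-! The function `r_* ↦ r` and the hypersurfaces `r_* = c - σ u`. -/

theorem tortoise_strictMonoOn {m : ℝ} (hm : 0 < m) : StrictMonoOn (tortoise m) (Ioi (2 * m)) := by
  intro a ha b _ hab
  have ha' : 0 < a - 2 * m := sub_pos.2 ha
  have hlog : Real.log (a - 2 * m) < Real.log (b - 2 * m) :=
    Real.log_lt_log ha' (by linarith)
  have := mul_lt_mul_of_pos_left hlog (by linarith : 0 < 2 * m)
  simp only [tortoise]
  linarith

theorem lt_radius {m : ℝ} (hm : 0 < m) (x : ℝ) : 2 * m < radius m x :=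
  Function.invFunOn_mem ((tortoise_bijOn hm).surjOn (mem_univ x))

theorem radius_pos {m : ℝ} (hm : 0 < m) (x : ℝ) : 0 < radius m x :=
  (by linarith : 0 < 2 * m).trans (lt_radius hm x)

theorem tortoise_radius {m : ℝ} (hm : 0 < m) (x : ℝ) : tortoise m (radius m x) = x :=
  Function.invFunOn_eq ((tortoise_bijOn hm).surjOn (mem_univ x))

theorem radius_tortoise {m r : ℝ} (hm : 0 < m) (hr : 2 * m < r) : radius m (tortoise m r) = r :=
  (tortoise_bijOn hm).injOn (lt_radius hm _) hr (tortoise_radius hm _)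

theorem radius_strictMono {m : ℝ} (hm : 0 < m) : StrictMono (radius m) := by
  intro x y hxy
  rwa [← (tortoise_strictMonoOn hm).lt_iff_lt (lt_radius hm x) (lt_radius hm y),
    tortoise_radius hm, tortoise_radius hm]

/-- A monotone map onto an interval is continuous. The inverse function rule behind
`hasDerivAt_radius` needs this continuity first. -/
theorem continuous_radius {m : ℝ} (hm : 0 < m) : Continuous (radius m) := by
  let f : ℝ → Ioi (2 * m) := fun x => ⟨radius m x, lt_radius hm x⟩
  have hf : Continuous f := by
    refine Monotone.continuous_of_surjective (fun x y h => (radius_strictMono hm).monotone h) ?_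
    rintro ⟨r, hr⟩
    exact ⟨tortoise m r, Subtype.ext (radius_tortoise hm hr)⟩
  exact continuous_subtype_val.comp hf

theorem hasDerivAt_tortoise {m r : ℝ} (hr : 2 * m < r) :
    HasDerivAt (tortoise m) (1 + 2 * m * (1 / (r - 2 * m))) r := by
  have h := ((hasDerivAt_id' r).sub_const (2 * m)).log (sub_pos.2 hr).ne'
  exact (hasDerivAt_id' r).add (h.const_mul (2 * m))

theorem hasDerivAt_radius {m : ℝ} (hm : 0 < m) (x : ℝ) :
    HasDerivAt (radius m) (lapse m (1 / radius m x)) x := by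
  have hr := lt_radius hm x
  have h0 := radius_pos hm x
  have h1 : (0 : ℝ) < radius m x - 2 * m := sub_pos.2 hr
  have hne : 1 + 2 * m * (1 / (radius m x - 2 * m)) ≠ 0 := by positivity
  have := HasDerivAt.of_local_left_inverse (continuous_radius hm).continuousAt
    (hasDerivAt_tortoise hr) hne (Filter.Eventually.of_forall (tortoise_radius hm))
  refine this.congr_deriv ?_
  rw [lapse]
  field_simp
  ring

/-- The value of `R` at retarded time `u` on the hypersurface `r_* = c - σ u`. -/
noncomputable def lineR (m c σ u : ℝ) : ℝ := 1 / radius m (c - σ * u)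

theorem lineR_pos {m : ℝ} (hm : 0 < m) (c σ u : ℝ) : 0 < lineR m c σ u :=
  one_div_pos.2 (radius_pos hm _)

theorem two_mul_lineR_lt {m : ℝ} (hm : 0 < m) (c σ u : ℝ) : 2 * m * lineR m c σ u < 1 := by
  rw [lineR, mul_one_div, div_lt_one (radius_pos hm _)]
  exact lt_radius hm _

/-- Since `dr = F dr_*` and `R = 1 / r`, one has `dR = - F R² dr_*`, and `dr_* = - σ du` on the
hypersurface. -/
theorem hasDerivAt_lineR {m : ℝ} (hm : 0 < m) (c σ u : ℝ) :
    HasDerivAt (lineR m c σ) (σ * (lapse m (lineR m c σ u) * lineR m c σ u ^ 2)) u := by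
  have h0 := (radius_pos hm (c - σ * u)).ne'
  have h1 : HasDerivAt (fun v => c - σ * v) (-σ) u := by
    simpa using ((hasDerivAt_id' u).const_mul σ).const_sub c
  have h2 : HasDerivAt (fun v => (radius m (c - σ * v))⁻¹)
      (-(lapse m (lineR m c σ u) * -σ) / radius m (c - σ * u) ^ 2) u :=
    ((hasDerivAt_radius hm (c - σ * u)).comp u h1).inv h0
  have h3 : lineR m c σ = fun v => (radius m (c - σ * v))⁻¹ := by
    ext v; simp [lineR]
  have h4 : radius m (c - σ * u) = (lineR m c σ u)⁻¹ := by simp [lineR]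
  rw [← h3] at h2
  refine h2.congr_deriv ?_
  rw [h4]
  simp
  ring

theorem lineR_lt_lineR {m : ℝ} (hm : 0 < m) {c σ c' σ' u : ℝ} (h : c' - σ' * u < c - σ * u) :
    lineR m c σ u < lineR m c' σ' u :=
  one_div_lt_one_div_of_lt (radius_pos hm _) (radius_strictMono hm h)

theorem lineR_le_lineR {m : ℝ} (hm : 0 < m) {c σ c' σ' u : ℝ} (h : c' - σ' * u ≤ c - σ * u) :
    lineR m c σ u ≤ lineR m c' σ' u :=
  one_div_le_one_div_of_le (radius_pos hm _) ((radius_strictMono hm).monotone h)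

theorem eq_lineR {m R c σ u : ℝ} (hm : 0 < m) (hR : 0 < R) (hmR : 2 * m * R < 1)
    (h : tortoise m (1 / R) = c - σ * u) : R = lineR m c σ u := by
  rw [lineR, ← h, radius_tortoise hm, one_div_one_div]
  rwa [lt_div_iff₀ hR]

theorem hypR_eq_lineR (m : ℝ) {s : ℝ} (hs : s ≠ 0) : hypR m s = lineR m 0 (1 / s) := by
  ext u
  rw [hypR, if_neg hs, lineR]
  congr 2
  ring

theorem hypR_one (m : ℝ) : hypR m 1 = lineR m 0 1 := by
  simpa using hypR_eq_lineR m one_ne_zero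

/-- The condition `t ≥ 0` reads `r_* ≥ - u`. As `r_*` decreases in `R`, this is an upper bound on
`R` by its value on `{t = 0}`. -/
theorem mem_domain {m u₀ u R : ℝ} (hm : 0 < m) (hu : u ≤ u₀) (hR : 0 ≤ R)
    (hR' : R ≤ lineR m 0 1 u) : (u, R) ∈ domain m u₀ := by
  refine ⟨hu, ?_⟩
  rcases hR.eq_or_lt with rfl | h0
  · exact Or.inl rfl
  have h1 : 2 * m * R < 1 := by
    have := two_mul_lineR_lt hm 0 1 u
    nlinarith
  refine Or.inr ⟨h0, h1, ?_⟩
  have h2 : 2 * m < 1 / R := by rwa [lt_div_iff₀ h0]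
  have h3 : radius m (0 - 1 * u) ≤ 1 / R := by
    rw [le_one_div (radius_pos hm _) h0]
    exact hR'
  have h4 := ((tortoise_strictMonoOn hm).le_iff_le (lt_radius hm _) h2).2 h3
  rw [tortoise_radius hm] at h4
  simp only
  linarith

theorem mem_domainInterior {m u₀ u R : ℝ} (hm : 0 < m) (hu : u < u₀) (hR : 0 < R)
    (hR' : R < lineR m 0 1 u) : (u, R) ∈ domainInterior m u₀ := by
  have h1 : 2 * m * R < 1 := by
    have := two_mul_lineR_lt hm 0 1 u
    nlinarith
  refine ⟨hu, hR, h1, ?_⟩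
  have h2 : 2 * m < 1 / R := by rwa [lt_div_iff₀ hR]
  have h3 : radius m (0 - 1 * u) < 1 / R := by
    rw [lt_one_div (radius_pos hm _) hR]
    exact hR'
  have h4 := ((tortoise_strictMonoOn hm).lt_iff_lt (lt_radius hm _) h2).2 h3
  rw [tortoise_radius hm] at h4
  simp only
  linarith

/-- Far out, `u R ≥ - 5 / 4` and `F ≥ 3 / 4` in the future of `{t = 0}`. -/
theorem exists_far {m : ℝ} (hm : 0 < m) : ∃ U : ℝ, U < 0 ∧ ∀ u ≤ U, ∀ R : ℝ, 0 ≤ R →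
    R ≤ lineR m 0 1 u → -(5 / 4) ≤ u * R ∧ 8 * m * R ≤ 1 := by
  -- The constant `1 / (8 m)` turns `2 m log r` into at most `r / 4`, whence `r_* ≤ 5 r / 4`. The
  -- bound `r ≥ 8 m` gives `F ≥ 3/4`.
  have h1 : ∀ᶠ r : ℝ in Filter.atTop, ‖Real.log r‖ ≤ 1 / (8 * m) * ‖id r‖ :=
    Real.isLittleO_log_id_atTop.bound (by positivity)
  obtain ⟨M, hM⟩ := Filter.eventually_atTop.1 h1
  set N := max M (8 * m) with hN
  have hN8 : 8 * m ≤ N := le_max_right _ _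
  refine ⟨-(max 1 (tortoise m N)), by simp, ?_⟩
  intro u hu R hR hR'
  have hu1 : 1 ≤ -u := by
    have := le_max_left 1 (tortoise m N); linarith
  have huN : tortoise m N ≤ -u := by
    have := le_max_right 1 (tortoise m N); linarith
  set r := radius m (0 - 1 * u) with hr
  have hrpos : 0 < r := radius_pos hm _
  have hrm : 2 * m < r := lt_radius hm _
  have htr : tortoise m r = -u := by rw [hr, tortoise_radius hm]; ring
  have hNr : N ≤ r := by
    rw [← (tortoise_strictMonoOn hm).le_iff_le (show 2 * m < N by linarith) hrm, htr]
    exact huN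
  have hlog : Real.log (r - 2 * m) ≤ Real.log r :=
    Real.log_le_log (by linarith) (by linarith)
  have hlog2 := hM r ((le_max_left _ _).trans hNr)
  rw [id, Real.norm_eq_abs, Real.norm_eq_abs, abs_of_pos hrpos] at hlog2
  have hlog3 := (le_abs_self _).trans hlog2
  have hlog4 : 2 * m * Real.log r ≤ r / 4 := by
    have := mul_le_mul_of_nonneg_left hlog3 (by linarith : 0 ≤ 2 * m)
    refine this.trans (le_of_eq ?_)
    field_simp
    norm_num
  have hmlog := mul_le_mul_of_nonneg_left hlog (by linarith : 0 ≤ 2 * m)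
  have hur : -u ≤ 5 / 4 * r := by
    rw [← htr, tortoise]; linarith
  have hRr : R * r ≤ 1 := by
    have : R ≤ 1 / r := hR'
    rwa [le_div_iff₀ hrpos] at this
  constructor
  · nlinarith
  · nlinarith

/-! Regularity of the components. -/

theorem contMDiff_spherePt :
    ContMDiff 𝓘(ℝ, Fin 4 → ℝ) (𝓡 2) ∞ fun x : Fin 4 → ℝ => spherePt (x 2) (x 3) := by
  apply ContMDiff.codRestrict_sphere
  apply ContDiff.contMDiff
  refine contDiff_euclidean.2 fun i => ?_
  fin_cases i <;> simp <;> fun_prop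

theorem contDiffOn_field {m u₀ : ℝ} {B : BilinField} (hB : IsMaxwellField m u₀ B) :
    ContDiffOn ℝ 1 (fun x : Fin 4 → ℝ => B (x 0, x 1, spherePt (x 2) (x 3)))
      {x | (x 0, x 1) ∈ domain m u₀} := by
  have h0 : ContMDiff 𝓘(ℝ, Fin 4 → ℝ) 𝓘(ℝ, ℝ) ∞ fun x : Fin 4 → ℝ => x 0 :=
    ContDiff.contMDiff (by fun_prop)
  have h1 : ContMDiff 𝓘(ℝ, Fin 4 → ℝ) 𝓘(ℝ, ℝ) ∞ fun x : Fin 4 → ℝ => x 1 :=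
    ContDiff.contMDiff (by fun_prop)
  have hG := h0.prodMk (h1.prodMk contMDiff_spherePt)
  have h := hB.smooth.comp (s := {x : Fin 4 → ℝ | (x 0, x 1) ∈ domain m u₀}) hG.contMDiffOn
    (fun x hx => hx)
  exact (contMDiffOn_iff_contDiffOn.1 h).of_le (by exact_mod_cast le_top)

theorem contDiffWithinAt_cval {b : (Fin 4 → ℝ) → (Vec →L[ℝ] Vec →L[ℝ] ℝ)}
    {X Y : (Fin 4 → ℝ) → Vec × Vec} {s : Set (Fin 4 → ℝ)} {x : Fin 4 → ℝ}
    (hb : ContDiffWithinAt ℝ 1 b s x) (hX : ContDiffWithinAt ℝ 1 X s x)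
    (hY : ContDiffWithinAt ℝ 1 Y s x) :
    ContDiffWithinAt ℝ 1 (fun x => cval (b x) (X x) (Y x)) s x := by
  simp only [cval, Complex.mk_eq_add_mul_I]
  have hre : ContDiffWithinAt ℝ 1
      (fun x => b x (X x).1 (Y x).1 - b x (X x).2 (Y x).2) s x :=
    ((hb.clm_apply hX.fst).clm_apply hY.fst).sub ((hb.clm_apply hX.snd).clm_apply hY.snd)
  have him : ContDiffWithinAt ℝ 1
      (fun x => b x (X x).1 (Y x).2 + b x (X x).2 (Y x).1) s x :=
    ((hb.clm_apply hX.fst).clm_apply hY.snd).add ((hb.clm_apply hX.snd).clm_apply hY.fst)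
  exact (Complex.ofRealCLM.contDiff.comp_contDiffWithinAt hre).add
    ((Complex.ofRealCLM.contDiff.comp_contDiffWithinAt him).mul contDiffWithinAt_const)

theorem lapse_pos_of_mem_domain {m u₀ : ℝ} {q : ℝ × ℝ} (hq : q ∈ domain m u₀) :
    0 < lapse m q.2 := by
  rcases hq.2 with h | h
  · simp [lapse, h]
  · rw [lapse]; linarith [h.2.1]

theorem domainInterior_subset (m u₀ : ℝ) : domainInterior m u₀ ⊆ domain m u₀ :=
  fun _ h => ⟨h.1.le, Or.inr ⟨h.2.1, h.2.2.1, h.2.2.2.le⟩⟩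

theorem contDiff_eTheta : ContDiff ℝ 1 fun x : Fin 4 → ℝ => eTheta (x 2) (x 3) := by
  refine contDiff_euclidean.2 fun i => ?_
  fin_cases i <;> simp [eTheta] <;> fun_prop

theorem contDiff_ePhi : ContDiff ℝ 1 fun x : Fin 4 → ℝ => ePhi (x 3) := by
  refine contDiff_euclidean.2 fun i => ?_
  fin_cases i <;> simp [ePhi] <;> fun_prop

theorem contDiff_tetM : ContDiff ℝ 1 fun x : Fin 4 → ℝ => tetM (x 2) (x 3) := by
  have h1 := contDiff_eTheta
  have h2 := contDiff_ePhi
  unfold tetM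
  fun_prop

theorem contDiff_tetMbar : ContDiff ℝ 1 fun x : Fin 4 → ℝ => tetMbar (x 2) (x 3) := by
  have h1 := contDiff_eTheta
  have h2 := contDiff_ePhi
  unfold tetMbar
  fun_prop

theorem contDiffAt_tetL {m : ℝ} {x : Fin 4 → ℝ} (hx : 0 < lapse m (x 1)) :
    ContDiffAt ℝ 1 (fun x : Fin 4 → ℝ => tetL m (x 1)) x := by
  have h : ContDiffAt ℝ 1 (fun x : Fin 4 → ℝ => lapse m (x 1)) x := by unfold lapse; fun_prop
  have h1 : ContDiffAt ℝ 1 (fun x : Fin 4 → ℝ => √(lapse m (x 1) / 2)) x :=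
    (h.div_const 2).sqrt (half_pos hx).ne'
  unfold tetL
  fun_prop

theorem contDiffAt_tetN {m : ℝ} {x : Fin 4 → ℝ} (hx : 0 < lapse m (x 1)) :
    ContDiffAt ℝ 1 (fun x : Fin 4 → ℝ => tetN m (x 1)) x := by
  have h : ContDiffAt ℝ 1 (fun x : Fin 4 → ℝ => lapse m (x 1)) x := by unfold lapse; fun_prop
  have h1 : ContDiffAt ℝ 1 (fun x : Fin 4 → ℝ => √(2 / lapse m (x 1))) x :=
    (contDiffAt_const.div h hx.ne').sqrt (div_pos two_pos hx).ne'
  unfold tetN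
  fun_prop

/-- The components `φ₀, φ₁, φ₂` as functions on `ℝ⁴`. -/
noncomputable def component (m : ℝ) (B : BilinField) : Fin 3 → (Fin 4 → ℝ) → ℂ :=
  ![fun x => phi0 m B (x 0) (x 1) (x 2) (x 3), fun x => phi1 m B (x 0) (x 1) (x 2) (x 3),
    fun x => phi2 m B (x 0) (x 1) (x 2) (x 3)]

/-- The frame is singular at the poles of `S²`, but as a function of the angles `(θ, φ)` it is
smooth for all values. The components are therefore regular up to `θ = 0` and `θ = π`, and no
neighbourhood of the poles has to be removed. -/
theorem contDiffOn_component {m u₀ : ℝ} {B : BilinField} (hB : IsMaxwellField m u₀ B)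
    (j : Fin 3) : ContDiffOn ℝ 1 (component m B j) {x | (x 0, x 1) ∈ domain m u₀} := by
  intro x hx
  have hb := contDiffOn_field hB x hx
  have hF : 0 < lapse m (x 1) := lapse_pos_of_mem_domain hx
  have hl := (contDiffAt_tetL hF).contDiffWithinAt (s := {x | (x 0, x 1) ∈ domain m u₀})
  have hn := (contDiffAt_tetN hF).contDiffWithinAt (s := {x | (x 0, x 1) ∈ domain m u₀})
  have hm := contDiff_tetM.contDiffAt.contDiffWithinAt
    (x := x) (s := {x | (x 0, x 1) ∈ domain m u₀})
  have hmb := contDiff_tetMbar.contDiffAt.contDiffWithinAt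
    (x := x) (s := {x | (x 0, x 1) ∈ domain m u₀})
  fin_cases j
  · exact contDiffWithinAt_cval hb hl hm
  · exact ((contDiffWithinAt_cval hb hl hn).add (contDiffWithinAt_cval hb hmb hm)).div_const 2
  · exact contDiffWithinAt_cval hb hmb hn

theorem domain_mem_nhds {m u₀ : ℝ} {x : Fin 4 → ℝ}
    (hx : (x 0, x 1) ∈ domainInterior m u₀) :
    {x : Fin 4 → ℝ | (x 0, x 1) ∈ domain m u₀} ∈ nhds x := by
  obtain ⟨h1, h2, h3, h4⟩ := hx
  simp only at h1 h2 h3 h4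
  have hr : 2 * m < 1 / x 1 := by rwa [lt_div_iff₀ h2]
  have c0 : ContinuousAt (fun y : Fin 4 → ℝ => y 0) x := (continuous_apply _).continuousAt
  have c1 : ContinuousAt (fun y : Fin 4 → ℝ => y 1) x := (continuous_apply _).continuousAt
  have c2 : ContinuousAt (fun y : Fin 4 → ℝ => tortoise m (1 / y 1)) x :=
    ContinuousAt.comp' (g := tortoise m) (f := fun y : Fin 4 → ℝ => 1 / y 1)
      (hasDerivAt_tortoise hr).continuousAt (continuousAt_const.div c1 h2.ne')
  filter_upwards [c0.eventually_lt continuousAt_const h1, continuousAt_const.eventually_lt c1 h2,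
    (continuousAt_const.mul c1).eventually_lt continuousAt_const h3,
    continuousAt_const.eventually_lt (c0.add c2) h4] with y y1 y2 y3 y4
  exact ⟨y1.le, Or.inr ⟨y2, y3, y4.le⟩⟩

theorem differentiableAt_component {m u₀ : ℝ} {B : BilinField}
    (hB : IsMaxwellField m u₀ B) (j : Fin 3) {x : Fin 4 → ℝ}
    (hx : (x 0, x 1) ∈ domainInterior m u₀) : DifferentiableAt ℝ (component m B j) x := by
  have hn := domain_mem_nhds hx
  exact ((contDiffOn_component hB j x (mem_of_mem_nhds hn)).contDiffAt hn).differentiableAt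
    one_ne_zero

theorem component_periodic (m : ℝ) (B : BilinField) (j : Fin 3) (u R θ : ℝ) :
    component m B j ![u, R, θ, 2 * Real.pi] = component m B j ![u, R, θ, 0] := by
  fin_cases j <;>
    simp [component, phi0, phi1, phi2, spherePt, tetM, tetMbar, eTheta, ePhi]

/-! The Maxwell equations without square roots of two, and the divergence of the current. -/

/-- The partial derivatives of the components. -/
noncomputable def partialComp (m : ℝ) (B : BilinField) (i : Fin 4) (j : Fin 3) (x : Fin 4 → ℝ) : ℂ :=
  fderiv ℝ (component m B j) x (Pi.single i 1)

section Equations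

variable {m u₀ : ℝ} {B : BilinField} {x : Fin 4 → ℝ}

theorem dU_component (j : Fin 3) (hd : DifferentiableAt ℝ (component m B j) x) :
    deriv (fun t => component m B j ![t, x 1, x 2, x 3]) (x 0) = partialComp m B 0 j x := by
  simpa only [partialComp, update_zero_vec] using (hasDerivAt_comp_update hd 0).deriv

theorem dR_component (j : Fin 3) (hd : DifferentiableAt ℝ (component m B j) x) :
    deriv (fun t => component m B j ![x 0, t, x 2, x 3]) (x 1) = partialComp m B 1 j x := by
  simpa only [partialComp, update_one_vec] using (hasDerivAt_comp_update hd 1).deriv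

theorem dTheta_component (j : Fin 3) (hd : DifferentiableAt ℝ (component m B j) x) :
    deriv (fun t => component m B j ![x 0, x 1, t, x 3]) (x 2) = partialComp m B 2 j x := by
  simpa only [partialComp, update_two_vec] using (hasDerivAt_comp_update hd 2).deriv

theorem dPhi_component (j : Fin 3) (hd : DifferentiableAt ℝ (component m B j) x) :
    deriv (fun t => component m B j ![x 0, x 1, x 2, t]) (x 3) = partialComp m B 3 j x := by
  simpa only [partialComp, update_three_vec] using (hasDerivAt_comp_update hd 3).deriv

/-- The Maxwell equations in terms of `k = √F`. -/
theorem maxwell_equations (hB : IsMaxwellField m u₀ B)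
    (hx : (x 0, x 1) ∈ domainInterior m u₀) (hθ : x 2 ∈ Ioo 0 Real.pi) :
    let k : ℝ := √(lapse m (x 1))
    let R : ℝ := x 1
    let s : ℝ := Real.sin (x 2)
    let c : ℝ := Real.cos (x 2)
    let D := fun i j => partialComp m B i j x
    let Φ := fun j => component m B j x
    (s * (D 0 0 + R ^ 2 * k ^ 2 / 2 * D 1 0) - k / 2 * (s * D 2 1 + Complex.I * D 3 1)
        - s * (5 * m * R ^ 2 - 2 * R) / 2 * Φ 0 = 0) ∧
      (s * k * D 1 1 + (s * D 2 0 - Complex.I * D 3 0 + c * Φ 0) = 0) ∧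
      (s * (D 0 1 + R ^ 2 * k ^ 2 / 2 * D 1 1)
        - k / 2 * (s * D 2 2 + Complex.I * D 3 2 + c * Φ 2) = 0) ∧
      (s * k ^ 2 * D 1 2 + k * (s * D 2 1 - Complex.I * D 3 1) - s * m * Φ 2 = 0) := by
  intro k R s c D Φ
  have hd := fun j => differentiableAt_component hB j hx
  have hF : 0 < lapse m (x 1) := 
    lapse_pos_of_mem_domain (domainInterior_subset m u₀ hx)
  have hk : 0 < k := Real.sqrt_pos.2 hF
  have hs : 0 < s := Real.sin_pos_of_mem_Ioo hθ
  have hk2 : lapse m R = k ^ 2 := (Real.sq_sqrt hF.le).symm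
  have e1 := hB.eq1 _ _ _ (x 3) hx hθ
  have e2 := hB.eq2 _ _ _ (x 3) hx hθ
  have e3 := hB.eq3 _ _ _ (x 3) hx hθ
  have e4 := hB.eq4 _ _ _ (x 3) hx hθ
  have hU := fun j => dU_component j (hd j)
  have hR := fun j => dR_component j (hd j)
  have hT := fun j => dTheta_component j (hd j)
  have hP := fun j => dPhi_component j (hd j)
  have r1 : √(lapse m (x 1) / 2) = k / √2 := Real.sqrt_div hF.le 2
  have r2 : √(2 / lapse m (x 1)) = √2 / k := Real.sqrt_div zero_le_two _
  have r3 : √(2 * lapse m (x 1)) = √2 * k := Real.sqrt_mul zero_le_two _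
  have dU0 : dU (phi0 m B) (x 0) (x 1) (x 2) (x 3) = D 0 0 := hU 0
  have dU1 : dU (phi1 m B) (x 0) (x 1) (x 2) (x 3) = D 0 1 := hU 1
  have dR0 : dR (phi0 m B) (x 0) (x 1) (x 2) (x 3) = D 1 0 := hR 0
  have dR1 : dR (phi1 m B) (x 0) (x 1) (x 2) (x 3) = D 1 1 := hR 1
  have dR2 : dR (phi2 m B) (x 0) (x 1) (x 2) (x 3) = D 1 2 := hR 2
  have dT0 : dTheta (phi0 m B) (x 0) (x 1) (x 2) (x 3) = D 2 0 := hT 0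
  have dT1 : dTheta (phi1 m B) (x 0) (x 1) (x 2) (x 3) = D 2 1 := hT 1
  have dT2 : dTheta (phi2 m B) (x 0) (x 1) (x 2) (x 3) = D 2 2 := hT 2
  have dP0 : dPhi (phi0 m B) (x 0) (x 1) (x 2) (x 3) = D 3 0 := hP 0
  have dP1 : dPhi (phi1 m B) (x 0) (x 1) (x 2) (x 3) = D 3 1 := hP 1
  have dP2 : dPhi (phi2 m B) (x 0) (x 1) (x 2) (x 3) = D 3 2 := hP 2
  have f0 : phi0 m B (x 0) (x 1) (x 2) (x 3) = Φ 0 := rfl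
  have f2 : phi2 m B (x 0) (x 1) (x 2) (x 3) = Φ 2 := rfl
  have hRR : x 1 = R := rfl
  have hss : Real.sin (x 2) = s := rfl
  have hcc : Real.cos (x 2) = c := rfl
  simp only [opD', opD, opDelta, opDelta', spinGamma, spinBeta, spinEps, dU0, dU1, dR0, dR1, dR2,
    dT0, dT1, dT2, dP0, dP1, dP2, f0, f2, r1, r2, r3] at e1 e2 e3 e4
  simp only [hRR, hss, hcc, hk2] at e1 e2 e3 e4
  have hq : ((√2 : ℝ) : ℂ) ^ 2 = 2 := by
    rw [← Complex.ofReal_pow, Real.sq_sqrt zero_le_two, Complex.ofReal_ofNat]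
  have hq0 : ((√2 : ℝ) : ℂ) ≠ 0 := by simp
  have hk0 : (k : ℂ) ≠ 0 := by exact_mod_cast hk.ne'
  have hs0 : (s : ℂ) ≠ 0 := by exact_mod_cast hs.ne'
  clear_value k R s c D Φ
  generalize √2 = q at *
  push_cast at e1 e2 e3 e4
  refine ⟨?_, ?_, ?_, ?_⟩
  · field_simp at e1
    rw [hq] at e1
    linear_combination e1 / 4
  · field_simp at e2
    linear_combination -e2
  · field_simp at e3
    rw [hq] at e3
    linear_combination e3 / 4
  · field_simp at e4
    linear_combination -e4

end Equations

/-- `2 + 2 u R + (u R)² F / 2`. -/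
noncomputable def morawetzG (m u R : ℝ) : ℝ := 2 + 2 * (u * R) + (u * R) ^ 2 * lapse m R / 2

/-- `V^u`, as a function on `ℝ⁴`. -/
noncomputable def fluxU (m : ℝ) (B : BilinField) (x : Fin 4 → ℝ) : ℝ :=
  2 / lapse m (x 1) * morawetzG m (x 0) (x 1) * Complex.normSq (component m B 0 x)
    + x 0 ^ 2 * Complex.normSq (component m B 1 x)

/-- `V^R`, as a function on `ℝ⁴`. -/
noncomputable def fluxR (m : ℝ) (B : BilinField) (x : Fin 4 → ℝ) : ℝ :=
  x 1 ^ 2 * morawetzG m (x 0) (x 1) * Complex.normSq (component m B 0 x)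
    - (2 + 2 * (x 0 * x 1)) * Complex.normSq (component m B 1 x)
    - x 0 ^ 2 * (lapse m (x 1) / 2) * Complex.normSq (component m B 2 x)

/-- The angular components of the current are the real and imaginary parts of
`(2 G / √F) φ̄₀ φ₁ + u² √F φ̄₁ φ₂`. -/
noncomputable def angularRe (m : ℝ) (B : BilinField) (x : Fin 4 → ℝ) : ℝ :=
  2 * morawetzG m (x 0) (x 1) / √(lapse m (x 1)) *
      ((component m B 0 x).re * (component m B 1 x).re
        + (component m B 0 x).im * (component m B 1 x).im)
    + x 0 ^ 2 * √(lapse m (x 1)) *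
      ((component m B 1 x).re * (component m B 2 x).re
        + (component m B 1 x).im * (component m B 2 x).im)

/-- The other angular component of the current, see `angularRe`. -/
noncomputable def angularIm (m : ℝ) (B : BilinField) (x : Fin 4 → ℝ) : ℝ :=
  2 * morawetzG m (x 0) (x 1) / √(lapse m (x 1)) *
      ((component m B 0 x).re * (component m B 1 x).im
        - (component m B 0 x).im * (component m B 1 x).re)
    + x 0 ^ 2 * √(lapse m (x 1)) *
      ((component m B 1 x).re * (component m B 2 x).im
        - (component m B 1 x).im * (component m B 2 x).re)

/-- The Morawetz current, weighted by a function `w` of `u` and by the density `sin θ`. -/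
noncomputable def weightedCurrent (m : ℝ) (B : BilinField) (w : ℝ → ℝ) :
    Fin 4 → (Fin 4 → ℝ) → ℝ :=
  ![fun x => w (x 0) * Real.sin (x 2) * fluxU m B x,
    fun x => w (x 0) * Real.sin (x 2) * fluxR m B x,
    fun x => -(w (x 0) * Real.sin (x 2) * angularRe m B x),
    fun x => w (x 0) * angularIm m B x]

/-- The divergence of `weightedCurrent`. -/
noncomputable def weightedError (m : ℝ) (B : BilinField) (w w' : ℝ → ℝ) (x : Fin 4 → ℝ) : ℝ :=
  Real.sin (x 2) * (w (x 0) * (4 * m * x 1 ^ 2 / lapse m (x 1) * (3 + x 0 * x 1)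
    * Complex.normSq (component m B 0 x)) + w' (x 0) * fluxU m B x)

theorem HasDerivAt.complex_re {f : ℝ → ℂ} {f' : ℂ} {t : ℝ} (h : HasDerivAt f f' t) :
    HasDerivAt (fun t => (f t).re) f'.re t :=
  Complex.reCLM.hasFDerivAt.comp_hasDerivAt t h

theorem HasDerivAt.complex_im {f : ℝ → ℂ} {f' : ℂ} {t : ℝ} (h : HasDerivAt f f' t) :
    HasDerivAt (fun t => (f t).im) f'.im t :=
  Complex.imCLM.hasFDerivAt.comp_hasDerivAt t h

theorem HasDerivAt.complex_normSq {f : ℝ → ℂ} {f' : ℂ} {t : ℝ} (h : HasDerivAt f f' t) :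
    HasDerivAt (fun t => Complex.normSq (f t)) (2 * ((f t).re * f'.re + (f t).im * f'.im)) t := by
  have h1 := HasDerivAt.complex_re h
  have h2 := HasDerivAt.complex_im h
  simp only [Complex.normSq_apply]
  exact ((h1.mul h1).add (h2.mul h2)).congr_deriv (by ring)

section

variable {m u₀ : ℝ} {B : BilinField} {w w' : ℝ → ℝ}

theorem continuousOn_component (hB : IsMaxwellField m u₀ B) (j : Fin 3) :
    ContinuousOn (component m B j) {x | (x 0, x 1) ∈ domain m u₀} :=
  (contDiffOn_component hB j).continuousOn

theorem continuousOn_fluxU (hB : IsMaxwellField m u₀ B) :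
    ContinuousOn (fluxU m B) {x | (x 0, x 1) ∈ domain m u₀} := by
  have hN := fun j => Complex.continuous_normSq.comp_continuousOn (continuousOn_component hB j)
  have hl : ContinuousOn (fun x : Fin 4 → ℝ => 2 / lapse m (x 1))
      {x | (x 0, x 1) ∈ domain m u₀} :=
    ContinuousOn.div (by fun_prop) (by unfold lapse; fun_prop)
      fun x hx => (lapse_pos_of_mem_domain hx).ne'
  have hg : Continuous fun x : Fin 4 → ℝ => morawetzG m (x 0) (x 1) := by
    unfold morawetzG lapse; fun_prop
  exact ((hl.mul hg.continuousOn).mul (hN 0)).add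
    ((((continuous_apply 0).pow 2).continuousOn).mul (hN 1))

theorem continuousOn_fluxR (hB : IsMaxwellField m u₀ B) :
    ContinuousOn (fluxR m B) {x | (x 0, x 1) ∈ domain m u₀} := by
  have hN := fun j => Complex.continuous_normSq.comp_continuousOn (continuousOn_component hB j)
  have h0 : Continuous fun x : Fin 4 → ℝ => x 1 ^ 2 * morawetzG m (x 0) (x 1) := by
    unfold morawetzG lapse; fun_prop
  have h1 : Continuous fun x : Fin 4 → ℝ => 2 + 2 * (x 0 * x 1) := by fun_prop
  have h2 : Continuous fun x : Fin 4 → ℝ => x 0 ^ 2 * (lapse m (x 1) / 2) := by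
    unfold lapse; fun_prop
  exact ((h0.continuousOn.mul (hN 0)).sub (h1.continuousOn.mul (hN 1))).sub
    (h2.continuousOn.mul (hN 2))

theorem continuousOn_angular (hB : IsMaxwellField m u₀ B) :
    ContinuousOn (angularRe m B) {x | (x 0, x 1) ∈ domain m u₀} ∧
      ContinuousOn (angularIm m B) {x | (x 0, x 1) ∈ domain m u₀} := by
  have hr := fun j => Complex.continuous_re.comp_continuousOn (continuousOn_component hB j)
  have hi := fun j => Complex.continuous_im.comp_continuousOn (continuousOn_component hB j)
  have hk : Continuous fun x : Fin 4 → ℝ => √(lapse m (x 1)) := by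
    unfold lapse; fun_prop
  have hg : Continuous fun x : Fin 4 → ℝ => 2 * morawetzG m (x 0) (x 1) := by
    unfold morawetzG lapse; fun_prop
  have hA : ContinuousOn (fun x : Fin 4 → ℝ => 2 * morawetzG m (x 0) (x 1) / √(lapse m (x 1)))
      {x | (x 0, x 1) ∈ domain m u₀} :=
    hg.continuousOn.div hk.continuousOn
      fun x hx => (Real.sqrt_pos.2 (lapse_pos_of_mem_domain hx)).ne'
  have hC : ContinuousOn (fun x : Fin 4 → ℝ => x 0 ^ 2 * √(lapse m (x 1)))
      {x | (x 0, x 1) ∈ domain m u₀} := (((continuous_apply 0).pow 2).mul hk).continuousOn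
  exact ⟨(hA.mul (((hr 0).mul (hr 1)).add ((hi 0).mul (hi 1)))).add
      (hC.mul (((hr 1).mul (hr 2)).add ((hi 1).mul (hi 2)))),
    (hA.mul (((hr 0).mul (hi 1)).sub ((hi 0).mul (hr 1)))).add
      (hC.mul (((hr 1).mul (hi 2)).sub ((hi 1).mul (hr 2))))⟩

theorem continuousOn_weightedCurrent (hB : IsMaxwellField m u₀ B) {S : Set (Fin 4 → ℝ)}
    (hS : S ⊆ {x | (x 0, x 1) ∈ domain m u₀}) (hw : ContinuousOn (fun x : Fin 4 → ℝ => w (x 0)) S)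
    (i : Fin 4) : ContinuousOn (weightedCurrent m B w i) S := by
  have hs : ContinuousOn (fun x : Fin 4 → ℝ => Real.sin (x 2)) S := by fun_prop
  fin_cases i
  · exact (hw.mul hs).mul ((continuousOn_fluxU hB).mono hS)
  · exact (hw.mul hs).mul ((continuousOn_fluxR hB).mono hS)
  · exact ((hw.mul hs).mul ((continuousOn_angular hB).1.mono hS)).neg
  · exact hw.mul ((continuousOn_angular hB).2.mono hS)

theorem continuousOn_weightedError (hB : IsMaxwellField m u₀ B) {S : Set (Fin 4 → ℝ)}
    (hS : S ⊆ {x | (x 0, x 1) ∈ domain m u₀}) (hw : ContinuousOn (fun x : Fin 4 → ℝ => w (x 0)) S)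
    (hw' : ContinuousOn (fun x : Fin 4 → ℝ => w' (x 0)) S) :
    ContinuousOn (weightedError m B w w') S := by
  have hs : ContinuousOn (fun x : Fin 4 → ℝ => Real.sin (x 2)) S := by fun_prop
  have hN := Complex.continuous_normSq.comp_continuousOn ((continuousOn_component hB 0).mono hS)
  have hl : ContinuousOn (fun x : Fin 4 → ℝ => 4 * m * x 1 ^ 2 / lapse m (x 1)) S :=
    ContinuousOn.div (by fun_prop) (by unfold lapse; fun_prop)
      fun x hx => (lapse_pos_of_mem_domain (hS hx)).ne'
  have h3 : ContinuousOn (fun x : Fin 4 → ℝ => 3 + x 0 * x 1) S := by fun_prop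
  exact hs.mul ((hw.mul ((hl.mul h3).mul hN)).add (hw'.mul ((continuousOn_fluxU hB).mono hS)))

theorem differentiableAt_weightedCurrent (hB : IsMaxwellField m u₀ B) {x : Fin 4 → ℝ}
    (hx : (x 0, x 1) ∈ domainInterior m u₀) (hw : DifferentiableAt ℝ w (x 0)) (i : Fin 4) :
    DifferentiableAt ℝ (weightedCurrent m B w i) x := by
  have hF : 0 < lapse m (x 1) := lapse_pos_of_mem_domain (domainInterior_subset m u₀ hx)
  have hd := fun j => differentiableAt_component hB j hx
  have hr : ∀ j, DifferentiableAt ℝ (fun x => (component m B j x).re) x :=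
    fun j => Complex.reCLM.differentiableAt.comp x (hd j)
  have hi : ∀ j, DifferentiableAt ℝ (fun x => (component m B j x).im) x :=
    fun j => Complex.imCLM.differentiableAt.comp x (hd j)
  have hN : ∀ j, DifferentiableAt ℝ (fun x => Complex.normSq (component m B j x)) x := by
    intro j
    simp only [Complex.normSq_apply]
    exact ((hr j).mul (hr j)).add ((hi j).mul (hi j))
  have hws : DifferentiableAt ℝ (fun x : Fin 4 → ℝ => w (x 0)) x :=
    DifferentiableAt.comp (g := w) (f := fun x : Fin 4 → ℝ => x 0) x hw (by fun_prop)
  have hs : DifferentiableAt ℝ (fun x : Fin 4 → ℝ => Real.sin (x 2)) x := by fun_prop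
  have hl : DifferentiableAt ℝ (fun x : Fin 4 → ℝ => lapse m (x 1)) x := by
    unfold lapse; fun_prop
  have hk : DifferentiableAt ℝ (fun x : Fin 4 → ℝ => √(lapse m (x 1))) x := hl.sqrt hF.ne'
  have hl3 : DifferentiableAt ℝ (fun x : Fin 4 → ℝ => lapse m (x 1) / 2) x := by
    unfold lapse; fun_prop
  have hg : DifferentiableAt ℝ (fun x : Fin 4 → ℝ => morawetzG m (x 0) (x 1)) x := by
    unfold morawetzG lapse; fun_prop
  have h0 : DifferentiableAt ℝ (fun x : Fin 4 → ℝ => x 0 ^ 2) x := by fun_prop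
  have h1 : DifferentiableAt ℝ (fun x : Fin 4 → ℝ => x 1 ^ 2) x := by fun_prop
  have h01 : DifferentiableAt ℝ (fun x : Fin 4 → ℝ => 2 + 2 * (x 0 * x 1)) x := by fun_prop
  have hA : DifferentiableAt ℝ
      (fun x : Fin 4 → ℝ => 2 * morawetzG m (x 0) (x 1) / √(lapse m (x 1))) x := by
    simp only [div_eq_mul_inv]
    exact (hg.const_mul 2).mul (hk.inv (Real.sqrt_pos.2 hF).ne')
  have hl2 : DifferentiableAt ℝ (fun x : Fin 4 → ℝ => 2 / lapse m (x 1)) x := by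
    simp only [div_eq_mul_inv]
    exact (differentiableAt_const 2).mul (hl.inv hF.ne')
  fin_cases i
  · exact (hws.mul hs).mul (((hl2.mul hg).mul (hN 0)).add (h0.mul (hN 1)))
  · exact (hws.mul hs).mul ((((h1.mul hg).mul (hN 0)).sub (h01.mul (hN 1))).sub
      ((h0.mul hl3).mul (hN 2)))
  · exact ((hws.mul hs).mul ((hA.mul (((hr 0).mul (hr 1)).add ((hi 0).mul (hi 1)))).add
      ((h0.mul hk).mul (((hr 1).mul (hr 2)).add ((hi 1).mul (hi 2)))))).neg
  · exact hws.mul ((hA.mul (((hr 0).mul (hi 1)).sub ((hi 0).mul (hr 1)))).add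
      ((h0.mul hk).mul (((hr 1).mul (hi 2)).sub ((hi 1).mul (hr 2)))))

/-- Pairing the four equations with conjugates of the components replaces the derivatives of
`|φ_j|²` along `l` and `n` by angular derivatives, which the angular components of the current
cancel. Only the failure of `T` to be Killing and the derivative of the weight survive. -/
theorem divergence_weightedCurrent (hB : IsMaxwellField m u₀ B) {x : Fin 4 → ℝ}
    (hx : (x 0, x 1) ∈ domainInterior m u₀) (hθ : x 2 ∈ Ioo 0 Real.pi)
    (hw : HasDerivAt w (w' (x 0)) (x 0)) :
    ∑ i, fderiv ℝ (weightedCurrent m B w i) x (Pi.single i 1) = weightedError m B w w' x := by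
  have hF : 0 < lapse m (x 1) := lapse_pos_of_mem_domain (domainInterior_subset m u₀ hx)
  have hR : 0 < x 1 := hx.2.1
  have hs : 0 < Real.sin (x 2) := Real.sin_pos_of_mem_Ioo hθ
  have hd : ∀ i j, HasDerivAt (fun t => component m B j (Function.update x i t))
      (partialComp m B i j x) (x i) :=
    fun i j => hasDerivAt_comp_update (differentiableAt_component hB j hx) i
  have hr := fun i j => HasDerivAt.complex_re (hd i j)
  have hi := fun i j => HasDerivAt.complex_im (hd i j)
  have hN := fun i j => HasDerivAt.complex_normSq (hd i j)
  have hX := differentiableAt_weightedCurrent hB hx hw.differentiableAt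
  have hg0 : HasDerivAt (fun t => morawetzG m t (x 1))
      (2 * x 1 + x 0 * x 1 ^ 2 * lapse m (x 1)) (x 0) := by
    have h := (hasDerivAt_id' (x 0)).mul_const (x 1)
    refine (((h.const_mul 2).const_add 2).add
      (((h.pow 2).mul_const (lapse m (x 1))).div_const 2)).congr_deriv ?_
    simp
    ring
  have hl1 : HasDerivAt (fun t => lapse m t) (-(2 * m)) (x 1) := by
    simpa [lapse] using ((hasDerivAt_id' (x 1)).const_mul (2 * m)).const_sub 1
  have hg1 : HasDerivAt (fun t => morawetzG m (x 0) t)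
      (2 * x 0 + x 0 ^ 2 * x 1 * lapse m (x 1) - m * (x 0 * x 1) ^ 2) (x 1) := by
    have h := (hasDerivAt_id' (x 1)).const_mul (x 0)
    refine (((h.const_mul 2).const_add 2).add
      (((h.pow 2).mul hl1).div_const 2)).congr_deriv ?_
    simp
    ring
  have d0 := fderiv_single_eq (hX 0) 0 ((hw.mul_const (Real.sin (x 2))).mul
    (((hg0.const_mul (2 / lapse m (x 1))).mul (hN 0 0)).add
      (((hasDerivAt_id' (x 0)).pow 2).mul (hN 0 1))))
  have d1 := fderiv_single_eq (hX 1) 1 (HasDerivAt.const_mul (w (x 0) * Real.sin (x 2))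
    ((((((hasDerivAt_id' (x 1)).pow 2).mul hg1).mul (hN 1 0)).sub
      (((((hasDerivAt_id' (x 1)).const_mul (x 0)).const_mul 2).const_add 2).mul (hN 1 1))).sub
      (((hl1.div_const 2).const_mul (x 0 ^ 2)).mul (hN 1 2))))
  have d2 := fderiv_single_eq (hX 2) 2 ((((Real.hasDerivAt_sin (x 2)).const_mul (w (x 0))).mul
    (((((hr 2 0).mul (hr 2 1)).add ((hi 2 0).mul (hi 2 1))).const_mul
        (2 * morawetzG m (x 0) (x 1) / √(lapse m (x 1)))).add
      ((((hr 2 1).mul (hr 2 2)).add ((hi 2 1).mul (hi 2 2))).const_mul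
        (x 0 ^ 2 * √(lapse m (x 1)))))).neg)
  have d3 := fderiv_single_eq (hX 3) 3 (HasDerivAt.const_mul (w (x 0))
    (((((hr 3 0).mul (hi 3 1)).sub ((hi 3 0).mul (hr 3 1))).const_mul
        (2 * morawetzG m (x 0) (x 1) / √(lapse m (x 1)))).add
      ((((hr 3 1).mul (hi 3 2)).sub ((hi 3 1).mul (hr 3 2))).const_mul
        (x 0 ^ 2 * √(lapse m (x 1))))))
  rw [Fin.sum_univ_four, d0, d1, d2, d3]
  obtain ⟨e1, e2, e3, e4⟩ := maxwell_equations hB hx hθ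
  have c1 := congrArg Complex.re e1
  have c1' := congrArg Complex.im e1
  have c2 := congrArg Complex.re e2
  have c2' := congrArg Complex.im e2
  have c3 := congrArg Complex.re e3
  have c3' := congrArg Complex.im e3
  have c4 := congrArg Complex.re e4
  have c4' := congrArg Complex.im e4
  have hk : 0 < √(lapse m (x 1)) := Real.sqrt_pos.2 hF
  have hk2 : lapse m (x 1) = √(lapse m (x 1)) ^ 2 := (Real.sq_sqrt hF.le).symm
  -- Eliminating `m` makes `k = √F` and `R` independent variables, so the final identity is one of
  -- rational functions.
  have hm : m = (1 - √(lapse m (x 1)) ^ 2) / (2 * x 1) := by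
    rw [← hk2, lapse]
    field_simp
    ring
  simp only [weightedError, fluxU, morawetzG, Function.update_eq_self, Complex.normSq_apply,
    Pi.mul_apply, Pi.add_apply, Pi.pow_apply, Nat.cast_ofNat]
  simp only [pow_two, Complex.add_re, Complex.add_im, Complex.sub_re, Complex.sub_im,
    Complex.mul_re, Complex.mul_im, Complex.ofReal_re, Complex.ofReal_im, Complex.I_re,
    Complex.I_im, Complex.zero_re, Complex.zero_im, Complex.div_ofNat_re, Complex.div_ofNat_im,
    Complex.re_ofNat, Complex.im_ofNat] at c1 c1' c2 c2' c3 c3' c4 c4'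
  generalize √(lapse m (x 1)) = k at *
  rw [hk2]
  clear d0 d1 d2 d3 hd hr hi hN hX hg0 hl1 hg1 e1 e2 e3 e4 hw hB hF hk2
  generalize w (x 0) = W at *
  generalize w' (x 0) = W' at *
  generalize Real.sin (x 2) = s at *
  generalize Real.cos (x 2) = c at *
  generalize hR' : x 1 = R at *
  generalize x 0 = u at *
  set G := 2 + 2 * (u * R) + (u * R) ^ 2 * k ^ 2 / 2 with hG
  -- The multipliers are `4 G φ̄₀ / F`, `-2 G φ̄₁ / √F`, `2 u² φ̄₁` and `- u² φ̄₂` for the four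
  -- equations in order, and real parts are taken.
  linear_combination (norm := skip)
    W * (4 * G / k ^ 2 * ((component m B 0 x).re * c1 + (component m B 0 x).im * c1')
      - 2 * G / k * ((component m B 1 x).re * c2 + (component m B 1 x).im * c2')
      + 2 * u ^ 2 * ((component m B 1 x).re * c3 + (component m B 1 x).im * c3')
      - u ^ 2 * ((component m B 2 x).re * c4 + (component m B 2 x).im * c4'))
  clear c1 c1' c2 c2' c3 c3' c4 c4'
  generalize component m B 0 x = φ₀
  generalize component m B 1 x = φ₁
  generalize component m B 2 x = φ₂
  generalize partialComp m B 0 0 x = A₀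
  generalize partialComp m B 0 1 x = A₁
  generalize partialComp m B 1 0 x = D₀
  generalize partialComp m B 1 1 x = D₁
  generalize partialComp m B 1 2 x = D₂
  generalize partialComp m B 2 0 x = T₀
  generalize partialComp m B 2 1 x = T₁
  generalize partialComp m B 2 2 x = T₂
  generalize partialComp m B 3 0 x = P₀
  generalize partialComp m B 3 1 x = P₁
  generalize partialComp m B 3 2 x = P₂
  rw [hG, hm]
  clear hm hG G
  field_simp
  ring

end

/-! Energy densities on the hypersurfaces `R = p u`, where `p' = σ F p²`. -/

/-- The energy density on the hypersurface `R = p u`, where `p' = σ F p²`. -/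
noncomputable def curveDensity (m : ℝ) (B : BilinField) (σ : ℝ) (p : ℝ → ℝ) (y : ℝ × ℝ × ℝ) : ℝ :=
  (σ * (lapse m (p y.1) * p y.1 ^ 2) * fluxU m B ![y.1, p y.1, y.2.1, y.2.2]
    - fluxR m B ![y.1, p y.1, y.2.1, y.2.2]) * Real.sin y.2.1

/-- The square roots in the tetrad cancel against those in the components of `T`. -/
theorem currentU_eq_fluxU {m R : ℝ} (hF : 0 < lapse m R) (B : BilinField) (u θ φ : ℝ) :
    currentU m B u R θ φ = fluxU m B ![u, R, θ, φ] := by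
  have h1 : √(2 / lapse m R) = √2 / √(lapse m R) := Real.sqrt_div zero_le_two _
  have h2 : √(lapse m R / 2) = √(lapse m R) / √2 := Real.sqrt_div hF.le 2
  have hk := Real.sqrt_pos.2 hF
  have hk2 : lapse m R = √(lapse m R) ^ 2 := (Real.sq_sqrt hF.le).symm
  have hq : √(2 : ℝ) ^ 2 = 2 := Real.sq_sqrt zero_le_two
  have hq0 : (0 : ℝ) < √2 := by positivity
  simp only [currentU, currentN, morawetzL, morawetzN, fluxU, morawetzG, component, h1, h2,
    Complex.sq_norm]
  simp
  generalize √(lapse m R) = k at *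
  rw [hk2]
  generalize √(2 : ℝ) = q at *
  field_simp
  rw [hq]
  ring

theorem currentR_eq_fluxR {m R : ℝ} (hF : 0 < lapse m R) (B : BilinField) (u θ φ : ℝ) :
    currentR m B u R θ φ = fluxR m B ![u, R, θ, φ] := by
  have h1 : √(2 / lapse m R) = √2 / √(lapse m R) := Real.sqrt_div zero_le_two _
  have h2 : √(lapse m R / 2) = √(lapse m R) / √2 := Real.sqrt_div hF.le 2
  have hk := Real.sqrt_pos.2 hF
  have hk2 : lapse m R = √(lapse m R) ^ 2 := (Real.sq_sqrt hF.le).symm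
  have hq : √(2 : ℝ) ^ 2 = 2 := Real.sq_sqrt zero_le_two
  have hq0 : (0 : ℝ) < √2 := by positivity
  simp only [currentR, currentL, currentN, morawetzL, morawetzN, fluxR, morawetzG, component,
    h1, h2, Complex.sq_norm]
  simp
  generalize √(lapse m R) = k at *
  rw [hk2]
  generalize √(2 : ℝ) = q at *
  field_simp
  rw [hq]
  ring

/-- The far region to the future of `{t = 0}`, as far as bounds on `u R` and `m R` go. -/
def IsFar (m u₀ : ℝ) : Prop :=
  u₀ < 0 ∧ ∀ u ≤ u₀, ∀ R : ℝ, 0 ≤ R → R ≤ lineR m 0 1 u → -(5 / 4) ≤ u * R ∧ 8 * m * R ≤ 1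

/-! ### Signs of the energy densities and of the bulk terms. -/

section Signs

variable {m u R : ℝ}

theorem lapse_ge (h : 8 * m * R ≤ 1) : 3 / 4 ≤ lapse m R := by
  rw [lapse]; linarith

/-- With `F ≥ 3/4` the expression is at least `2 + 2x + 3x²/8` for `x = u R`. The larger root of
this quadratic is `-4/3`, so the bound `x ≥ -5/4` leaves a margin. -/
theorem morawetzG_ge (h1 : -(5 / 4) ≤ u * R) (h : 8 * m * R ≤ 1) :
    1 / 16 ≤ morawetzG m u R := by
  have hF := lapse_ge h
  rw [morawetzG]
  have := mul_le_mul_of_nonneg_left hF (sq_nonneg (u * R))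
  nlinarith

theorem fluxU_nonneg {B : BilinField} {x : Fin 4 → ℝ} (h1 : -(5 / 4) ≤ x 0 * x 1)
    (h : 8 * m * x 1 ≤ 1) : 0 ≤ fluxU m B x := by
  have hF := lapse_ge h
  have hG := morawetzG_ge h1 h
  have := Complex.normSq_nonneg (component m B 0 x)
  have := Complex.normSq_nonneg (component m B 1 x)
  rw [fluxU]
  have : 0 ≤ 2 / lapse m (x 1) * morawetzG m (x 0) (x 1) :=
    mul_nonneg (div_nonneg zero_le_two (by linarith)) (by linarith)
  positivity

/-- The coefficient `2σ - 1` of `|φ₀|²` shows the causal character: `σ = 1/2` is an incoming null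
hypersurface, on which `φ₀` is not seen, and for `σ > 1/2` all three components are controlled where
`u R ≠ 0`. -/
theorem slope_flux_eq {B : BilinField} {σ : ℝ} {x : Fin 4 → ℝ} (hF : lapse m (x 1) ≠ 0) :
    σ * (lapse m (x 1) * x 1 ^ 2) * fluxU m B x - fluxR m B x =
      (2 * σ - 1) * x 1 ^ 2 * morawetzG m (x 0) (x 1) * Complex.normSq (component m B 0 x)
        + ((σ - 1 / 2) * (x 0 * x 1) ^ 2 * lapse m (x 1) + morawetzG m (x 0) (x 1))
          * Complex.normSq (component m B 1 x)
        + x 0 ^ 2 * lapse m (x 1) / 2 * Complex.normSq (component m B 2 x) := by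
  rw [fluxU, fluxR]
  field_simp
  rw [morawetzG]
  ring

theorem slope_flux_nonneg {B : BilinField} {σ : ℝ} {x : Fin 4 → ℝ} (hσ : 1 / 2 ≤ σ)
    (h1 : -(5 / 4) ≤ x 0 * x 1) (h : 8 * m * x 1 ≤ 1) :
    0 ≤ σ * (lapse m (x 1) * x 1 ^ 2) * fluxU m B x - fluxR m B x := by
  have hF := lapse_ge h
  have hG := morawetzG_ge h1 h
  have hF0 : 0 < lapse m (x 1) := by linarith
  have hG0 : 0 < morawetzG m (x 0) (x 1) := by linarith
  have n0 := Complex.normSq_nonneg (component m B 0 x)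
  have n1 := Complex.normSq_nonneg (component m B 1 x)
  have n2 := Complex.normSq_nonneg (component m B 2 x)
  have hσ' : 0 ≤ σ - 1 / 2 := by linarith
  have hσ2 : 0 ≤ 2 * σ - 1 := by linarith
  rw [slope_flux_eq hF0.ne']
  positivity

theorem component_eq_zero_of_slope_flux {B : BilinField} {σ : ℝ} {x : Fin 4 → ℝ}
    (hσ : 1 / 2 < σ) (h1 : -(5 / 4) ≤ x 0 * x 1) (h : 8 * m * x 1 ≤ 1)
    (h0 : x 0 ≠ 0) (hR : x 1 ≠ 0)
    (hz : σ * (lapse m (x 1) * x 1 ^ 2) * fluxU m B x - fluxR m B x = 0) (j : Fin 3) :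
    component m B j x = 0 := by
  have hF := lapse_ge h
  have hG := morawetzG_ge h1 h
  have hF0 : 0 < lapse m (x 1) := by linarith
  have hG0 : 0 < morawetzG m (x 0) (x 1) := by linarith
  have n0 := Complex.normSq_nonneg (component m B 0 x)
  have n1 := Complex.normSq_nonneg (component m B 1 x)
  have n2 := Complex.normSq_nonneg (component m B 2 x)
  have hσ' : 0 < σ - 1 / 2 := by linarith
  have hσ2 : 0 < 2 * σ - 1 := by linarith
  rw [slope_flux_eq hF0.ne'] at hz
  have c0 : 0 < (2 * σ - 1) * x 1 ^ 2 * morawetzG m (x 0) (x 1) := by positivity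
  have c1 : 0 < (σ - 1 / 2) * (x 0 * x 1) ^ 2 * lapse m (x 1) + morawetzG m (x 0) (x 1) := by
    positivity
  have c2 : 0 < x 0 ^ 2 * lapse m (x 1) / 2 := by positivity
  have t0 := mul_nonneg c0.le n0
  have t1 := mul_nonneg c1.le n1
  have t2 := mul_nonneg c2.le n2
  rw [← Complex.normSq_eq_zero]
  fin_cases j
  · exact (mul_eq_zero.1 (by linarith : _ * Complex.normSq (component m B 0 x) = 0)).resolve_left
      c0.ne'
  · exact (mul_eq_zero.1 (by linarith : _ * Complex.normSq (component m B 1 x) = 0)).resolve_left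
      c1.ne'
  · exact (mul_eq_zero.1 (by linarith : _ * Complex.normSq (component m B 2 x) = 0)).resolve_left
      c2.ne'

theorem weightedError_one_nonneg {B : BilinField} {x : Fin 4 → ℝ} (hm : 0 < m)
    (h1 : -(5 / 4) ≤ x 0 * x 1) (h : 8 * m * x 1 ≤ 1) (hs : 0 ≤ Real.sin (x 2)) :
    0 ≤ weightedError m B (fun _ => 1) (fun _ => 0) x := by
  have hF := lapse_ge h
  have hF0 : 0 < lapse m (x 1) := by linarith
  have n0 := Complex.normSq_nonneg (component m B 0 x)
  have : 0 ≤ 3 + x 0 * x 1 := by linarith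
  rw [weightedError]
  simp only [zero_mul, add_zero, one_mul]
  positivity

/-! ### The exponential weight. -/

/-- The weight that absorbs the error term. -/
noncomputable def expWeight (m u : ℝ) : ℝ := Real.exp (160 * m / u)

/-- The derivative of `expWeight`. -/
noncomputable def expWeight' (m u : ℝ) : ℝ := -(160 * m / u ^ 2) * Real.exp (160 * m / u)

theorem hasDerivAt_expWeight (m : ℝ) {u : ℝ} (hu : u ≠ 0) :
    HasDerivAt (expWeight m) (expWeight' m u) u := by
  have h := ((hasDerivAt_const u (160 * m)).fun_div (hasDerivAt_id' u) hu).exp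
  refine h.congr_deriv ?_
  rw [expWeight']
  ring

theorem continuousAt_expWeight' (m : ℝ) {u : ℝ} (hu : u ≠ 0) :
    ContinuousAt (expWeight' m) u := by
  unfold expWeight'
  have h1 : ContinuousAt (fun u : ℝ => 160 * m / u ^ 2) u :=
    ContinuousAt.div (by fun_prop) (by fun_prop) (pow_ne_zero 2 hu)
  have h2 : ContinuousAt (fun u : ℝ => 160 * m / u) u :=
    ContinuousAt.div (by fun_prop) (by fun_prop) hu
  exact h1.neg.mul h2.rexp

/-- The derivative of the weight contributes `-(160 m / u²) V^u`. Its `φ₀` part dominates the bulk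
term because `80 G ≥ 80 / 16 = 5`, whereas `(uR)² (3 + uR) ≤ 3 · 25/16 < 5` for `-5/4 ≤ uR ≤ 0`. -/
theorem weightedError_expWeight_nonpos {B : BilinField} {x : Fin 4 → ℝ} (hm : 0 < m)
    (h0 : x 0 ≠ 0) (h1 : -(5 / 4) ≤ x 0 * x 1) (h2 : x 0 * x 1 ≤ 0) (h : 8 * m * x 1 ≤ 1)
    (hs : 0 ≤ Real.sin (x 2)) :
    weightedError m B (expWeight m) (expWeight' m) x ≤ 0 := by
  have hF := lapse_ge h
  have hG := morawetzG_ge h1 h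
  have hF0 : 0 < lapse m (x 1) := by linarith
  have n0 := Complex.normSq_nonneg (component m B 0 x)
  have n1 := Complex.normSq_nonneg (component m B 1 x)
  have hE : 0 < Real.exp (160 * m / x 0) := Real.exp_pos _
  have key : weightedError m B (expWeight m) (expWeight' m) x =
      -(Real.sin (x 2) * Real.exp (160 * m / x 0) *
        (4 * m / (lapse m (x 1) * x 0 ^ 2) *
            (80 * morawetzG m (x 0) (x 1) - (x 0 * x 1) ^ 2 * (3 + x 0 * x 1))
            * Complex.normSq (component m B 0 x)
          + 160 * m * Complex.normSq (component m B 1 x))) := by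
    rw [weightedError, expWeight, expWeight', fluxU]
    field_simp
    ring
  rw [key, neg_nonpos]
  have hq : (x 0 * x 1) ^ 2 * (3 + x 0 * x 1) ≤ 5 := by
    have a1 : (x 0 * x 1) ^ 2 ≤ 25 / 16 := by nlinarith
    have a2 : 0 ≤ 3 + x 0 * x 1 := by linarith
    nlinarith [sq_nonneg (x 0 * x 1)]
  have : 0 ≤ 80 * morawetzG m (x 0) (x 1) - (x 0 * x 1) ^ 2 * (3 + x 0 * x 1) := by linarith
  positivity

end Signs

/-! The weighted energy identity, and the finite speed of propagation. -/

/-- The curve `R = p u` satisfies `p' = σ F p²`. -/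
def IsRay (m σ : ℝ) (p : ℝ → ℝ) : Prop :=
  ∀ u, HasDerivAt p (σ * (lapse m (p u) * p u ^ 2)) u

theorem isRay_lineR {m : ℝ} (hm : 0 < m) (c σ : ℝ) : IsRay m σ (lineR m c σ) :=
  fun u => hasDerivAt_lineR hm c σ u

theorem IsRay.differentiable {m σ : ℝ} {p : ℝ → ℝ} (hp : IsRay m σ p) : Differentiable ℝ p :=
  fun u => (hp u).differentiableAt

theorem IsRay.differentiable_deriv {m σ : ℝ} {p : ℝ → ℝ} (hp : IsRay m σ p) :
    Differentiable ℝ fun u => σ * (lapse m (p u) * p u ^ 2) := by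
  have h := hp.differentiable
  unfold lapse
  fun_prop

/-- `sin θ V^u` on the segment `p β < R < q β` of `{u = β}`, parametrized by `[0, 1]`. -/
noncomputable def segmentDensity (m : ℝ) (B : BilinField) (p q : ℝ → ℝ) (β : ℝ)
    (y : ℝ × ℝ × ℝ) : ℝ :=
  (q β - p β) * (Real.sin y.2.1 * fluxU m B ![β, p β + y.1 * (q β - p β), y.2.1, y.2.2])

/-- The divergence theorem between `R = p u` and `{t = 0}`. By `p' = σ F p²`, the flux `V^R - p'
V^u` through a graph is minus its energy density. The angular faces contribute nothing, by the
factor `sin θ` and by periodicity in `φ`. -/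
theorem energy_identity {m u₀ α β σ : ℝ} {B : BilinField} {p w w' : ℝ → ℝ} (hm : 0 < m)
    (hB : IsMaxwellField m u₀ B) (hαβ : α ≤ β) (hβ : β ≤ u₀)
    (hw : ∀ u ∈ Icc α β, HasDerivAt w (w' u) u) (hw' : ContinuousOn w' (Icc α β))
    (hp : IsRay m σ p) (hp0 : ∀ u ∈ Icc α β, 0 ≤ p u)
    (hpq : ∀ u ∈ Icc α β, p u ≤ lineR m 0 1 u) (hpq' : ∀ u ∈ Ioo α β, p u < lineR m 0 1 u) :
    ∫ x in graphBox α β, (lineR m 0 1 (x 0) - p (x 0)) *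
        weightedError m B w w' (graphMap p (lineR m 0 1) x) =
      w β * (∫ y in Ioo 0 1 ×ˢ angles, segmentDensity m B p (lineR m 0 1) β y)
        - w α * (∫ y in Ioo 0 1 ×ˢ angles, segmentDensity m B p (lineR m 0 1) α y)
        + ((∫ y in Ioo α β ×ˢ angles, w y.1 * curveDensity m B σ p y)
          - ∫ y in Ioo α β ×ˢ angles, w y.1 * curveDensity m B 1 (lineR m 0 1) y) := by
  have hq := isRay_lineR hm 0 1
  have hreg : graphRegion p (lineR m 0 1) α β ⊆ {x | (x 0, x 1) ∈ domain m u₀} := by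
    rintro x ⟨h0, h1, -⟩
    exact mem_domain hm (h0.2.trans hβ) ((hp0 _ h0).trans h1.1) h1.2
  have hint : ∀ x ∈ graphInterior p (lineR m 0 1) α β, (x 0, x 1) ∈ domainInterior m u₀ := by
    rintro x ⟨h0, h1, -⟩
    exact mem_domainInterior hm (h0.2.trans_le hβ)
      ((hp0 _ (Ioo_subset_Icc_self h0)).trans_lt h1.1) h1.2
  have h0m : MapsTo (fun x : Fin 4 → ℝ => x 0) (graphRegion p (lineR m 0 1) α β) (Icc α β) :=
    fun x hx => hx.1
  have hwc : ContinuousOn w (Icc α β) := fun u hu => (hw u hu).continuousAt.continuousWithinAt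
  have hwc' : ContinuousOn (fun x : Fin 4 → ℝ => w (x 0)) (graphRegion p (lineR m 0 1) α β) :=
    hwc.comp (continuous_apply 0).continuousOn h0m
  have hwc'' : ContinuousOn (fun x : Fin 4 → ℝ => w' (x 0)) (graphRegion p (lineR m 0 1) α β) :=
    hw'.comp (continuous_apply 0).continuousOn h0m
  have key := integral_divergence_graph hαβ hp hq hp.differentiable_deriv
    hq.differentiable_deriv hpq hpq' (weightedCurrent m B w) (weightedError m B w w')
    (continuousOn_weightedCurrent hB hreg hwc') (continuousOn_weightedError hB hreg hwc' hwc'')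
    (fun x hx => differentiableAt_weightedCurrent hB (hint x hx)
      (hw _ (Ioo_subset_Icc_self hx.1)).differentiableAt)
    (fun x hx => divergence_weightedCurrent hB (hint x hx) hx.2.2.1
      (hw _ (Ioo_subset_Icc_self hx.1)))
    (fun x hx => by rcases hx with h | h <;> simp [weightedCurrent, h])
    (fun u v t => by simp [weightedCurrent, angularIm, component_periodic])
  rw [key]
  have hside : ∀ (τ : ℝ) (r : ℝ → ℝ),
      ∫ y in Ioo α β ×ˢ angles, (weightedCurrent m B w 1 ![y.1, r y.1, y.2.1, y.2.2]
        - τ * (lapse m (r y.1) * r y.1 ^ 2) * weightedCurrent m B w 0 ![y.1, r y.1, y.2.1, y.2.2])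
      = -∫ y in Ioo α β ×ˢ angles, w y.1 * curveDensity m B τ r y := by
    intro τ r
    rw [← integral_neg]
    congr 1
    ext y
    simp [weightedCurrent, curveDensity]
    ring
  have hends : ∀ γ, ∫ y in Ioo 0 1 ×ˢ angles, (lineR m 0 1 γ - p γ) *
        weightedCurrent m B w 0 ![γ, p γ + y.1 * (lineR m 0 1 γ - p γ), y.2.1, y.2.2]
      = w γ * ∫ y in Ioo 0 1 ×ˢ angles, segmentDensity m B p (lineR m 0 1) γ y := by
    intro γ
    rw [← integral_const_mul]
    congr 1
    ext y
    simp [weightedCurrent, segmentDensity]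
    ring
  rw [hside, hside, hends, hends]
  ring

theorem measurableSet_angles : MeasurableSet angles := measurableSet_Ioo.prod measurableSet_Ioo

theorem isOpen_angles : IsOpen angles := isOpen_Ioo.prod isOpen_Ioo

section

variable {m u₀ : ℝ} {B : BilinField}

theorem continuousOn_curveDensity {α β σ : ℝ} {p : ℝ → ℝ} (hm : 0 < m)
    (hB : IsMaxwellField m u₀ B) (hβ : β ≤ u₀) (hp : Continuous p)
    (hp0 : ∀ u ∈ Icc α β, 0 ≤ p u) (hpq : ∀ u ∈ Icc α β, p u ≤ lineR m 0 1 u) :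
    ContinuousOn (curveDensity m B σ p) (Icc α β ×ˢ univ) := by
  have hvec : Continuous fun y : ℝ × ℝ × ℝ => (![y.1, p y.1, y.2.1, y.2.2] : Fin 4 → ℝ) := by
    refine continuous_pi fun i => ?_
    fin_cases i <;> simp <;> fun_prop
  have hmaps : MapsTo (fun y : ℝ × ℝ × ℝ => (![y.1, p y.1, y.2.1, y.2.2] : Fin 4 → ℝ))
      (Icc α β ×ˢ univ) {x | (x 0, x 1) ∈ domain m u₀} := by
    rintro y ⟨hy, -⟩
    exact mem_domain hm (hy.2.trans hβ) (hp0 _ hy) (hpq _ hy)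
  have hU := (continuousOn_fluxU hB).comp hvec.continuousOn hmaps
  have hR := (continuousOn_fluxR hB).comp hvec.continuousOn hmaps
  have hl : Continuous fun y : ℝ × ℝ × ℝ => σ * (lapse m (p y.1) * p y.1 ^ 2) := by
    unfold lapse; fun_prop
  have hs : Continuous fun y : ℝ × ℝ × ℝ => Real.sin y.2.1 := by fun_prop
  exact ((hl.continuousOn.mul hU).sub hR).mul hs.continuousOn

theorem integrableOn_of_continuousOn_strip {f : ℝ × ℝ × ℝ → ℝ} {α β : ℝ}
    (hf : ContinuousOn f (Icc α β ×ˢ univ)) : IntegrableOn f (Ioo α β ×ˢ angles) := by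
  have hK : IsCompact (Icc α β ×ˢ (Icc (0 : ℝ) Real.pi ×ˢ Icc (0 : ℝ) (2 * Real.pi))) :=
    isCompact_Icc.prod (isCompact_Icc.prod isCompact_Icc)
  refine ((hf.mono ?_).integrableOn_compact hK).mono_set ?_
  · exact prod_mono_right (subset_univ _)
  · exact prod_mono Ioo_subset_Icc_self (prod_mono Ioo_subset_Icc_self Ioo_subset_Icc_self)

theorem sin_pos_of_mem_angles {a : ℝ × ℝ} (ha : a ∈ angles) : 0 < Real.sin a.1 :=
  Real.sin_pos_of_mem_Ioo ha.1

theorem curveDensity_nonneg {σ : ℝ} {p : ℝ → ℝ} (hfar : IsFar m u₀) (hσ : 1 / 2 ≤ σ)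
    {y : ℝ × ℝ × ℝ} (hy : y.1 ≤ u₀) (hp0 : 0 ≤ p y.1) (hpq : p y.1 ≤ lineR m 0 1 y.1)
    (ha : y.2 ∈ angles) : 0 ≤ curveDensity m B σ p y := by
  have h := hfar.2 _ hy _ hp0 hpq
  exact mul_nonneg (slope_flux_nonneg (x := ![y.1, p y.1, y.2.1, y.2.2]) hσ h.1 h.2)
    (sin_pos_of_mem_angles ha).le

theorem segmentDensity_nonneg {p q : ℝ → ℝ} {β : ℝ} (hfar : IsFar m u₀) (hβ : β ≤ u₀)
    (hp0 : 0 ≤ p β) (hpq : p β ≤ q β) (hq : q β ≤ lineR m 0 1 β) {y : ℝ × ℝ × ℝ}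
    (hy : y ∈ Ioo (0 : ℝ) 1 ×ˢ angles) : 0 ≤ segmentDensity m B p q β y := by
  obtain ⟨⟨h1, h2⟩, ha⟩ := hy
  have h0 : 0 ≤ p β + y.1 * (q β - p β) := by nlinarith
  have h := hfar.2 β hβ _ h0 (by nlinarith)
  exact mul_nonneg (sub_nonneg.2 hpq) (mul_nonneg (sin_pos_of_mem_angles ha).le
    (fluxU_nonneg (x := ![β, p β + y.1 * (q β - p β), y.2.1, y.2.2]) h.1 h.2))

theorem expWeight_pos (m u : ℝ) : 0 < expWeight m u := Real.exp_pos _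

/-- The weighted energy on `R = p u` is controlled by the weighted energy on `{t = 0}`, up to the
flux through the initial segment. -/
theorem weighted_energy_le {α β σ : ℝ} {p : ℝ → ℝ} (hm : 0 < m) (hfar : IsFar m u₀)
    (hB : IsMaxwellField m u₀ B) (hαβ : α ≤ β) (hβ : β ≤ u₀)
    (hp : IsRay m σ p) (hp0 : ∀ u ∈ Icc α β, 0 ≤ p u)
    (hpq : ∀ u ∈ Icc α β, p u ≤ lineR m 0 1 u) (hpq' : ∀ u ∈ Ioo α β, p u < lineR m 0 1 u)
    (hα : ∀ y ∈ Ioo (0 : ℝ) 1 ×ˢ angles, segmentDensity m B p (lineR m 0 1) α y = 0) :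
    ∫ y in Ioo α β ×ˢ angles, expWeight m y.1 * curveDensity m B σ p y ≤
      ∫ y in Ioo α β ×ˢ angles, expWeight m y.1 * curveDensity m B 1 (lineR m 0 1) y := by
  have hneg : ∀ u ∈ Icc α β, u < 0 := fun u hu => (hu.2.trans hβ).trans_lt hfar.1
  have key := energy_identity (w := expWeight m) (w' := expWeight' m) hm hB hαβ hβ
    (fun u hu => hasDerivAt_expWeight m (hneg u hu).ne)
    (fun u hu => (continuousAt_expWeight' m (hneg u hu).ne).continuousWithinAt) hp hp0 hpq hpq'
  have hms : MeasurableSet (Ioo (0 : ℝ) 1 ×ˢ angles) := measurableSet_Ioo.prod measurableSet_angles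
  rw [setIntegral_congr_fun hms (g := fun _ => 0) hα, integral_zero, mul_zero, sub_zero] at key
  have h1 : 0 ≤ expWeight m β *
      ∫ y in Ioo 0 1 ×ˢ angles, segmentDensity m B p (lineR m 0 1) β y := by
    have hb : β ∈ Icc α β := right_mem_Icc.2 hαβ
    exact mul_nonneg (expWeight_pos m β).le (setIntegral_nonneg hms fun y hy =>
      segmentDensity_nonneg hfar hβ (hp0 β hb) (hpq β hb) le_rfl hy)
  have h2 : ∫ x in graphBox α β, (lineR m 0 1 (x 0) - p (x 0)) *
      weightedError m B (expWeight m) (expWeight' m) (graphMap p (lineR m 0 1) x) ≤ 0 := by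
    refine setIntegral_nonpos measurableSet_Icc fun x hx => ?_
    obtain ⟨g0, g1, g2, -⟩ := graphMap_mem_graphRegion hpq hx
    have hx0 := hneg _ g0
    have hR := (hp0 _ g0).trans g1.1
    have h := hfar.2 _ (g0.2.trans hβ) _ hR g1.2
    refine mul_nonpos_of_nonneg_of_nonpos (sub_nonneg.2 (hpq _ g0)) ?_
    exact weightedError_expWeight_nonpos hm hx0.ne h.1
      (mul_nonpos_of_nonpos_of_nonneg hx0.le hR) h.2 (Real.sin_nonneg_of_mem_Icc g2)
  linarith

theorem component_eq_zero_on_initial (hdata : DataSupportedAwayFromI0 m u₀ B) :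
    ∃ L : ℝ, L ≤ u₀ ∧ ∀ u < L, ∀ θ ∈ Ioo 0 Real.pi, ∀ φ : ℝ, ∀ j,
      component m B j ![u, lineR m 0 1 u, θ, φ] = 0 := by
  obtain ⟨L, hL⟩ := hdata
  refine ⟨min L u₀, min_le_right _ _, fun u hu θ hθ φ j => ?_⟩
  have h := hL u (hu.le.trans (min_le_right _ _)) (hu.trans_le (min_le_left _ _)) θ hθ φ
  rw [hypR_one] at h
  fin_cases j
  exacts [h.1, h.2.1, h.2.2]

/-- Finite speed of propagation. -/
theorem component_eq_zero_of_lt {L : ℝ} (hm : 0 < m) (hfar : IsFar m u₀)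
    (hB : IsMaxwellField m u₀ B) (hL : L ≤ u₀)
    (hdata : ∀ u < L, ∀ θ ∈ Ioo 0 Real.pi, ∀ φ : ℝ, ∀ j,
      component m B j ![u, lineR m 0 1 u, θ, φ] = 0)
    {u R : ℝ} {a : ℝ × ℝ} (hu : u < L) (hR : 0 < R) (hR' : R < lineR m 0 1 u) (ha : a ∈ angles)
    (j : Fin 3) : component m B j ![u, R, a.1, a.2] = 0 := by
  obtain ⟨-, -, h3, h4⟩ := mem_domainInterior hm (hu.trans_le hL) hR hR'
  simp only at h3 h4
  set ρ := tortoise m (1 / R) with hρ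
  obtain ⟨β, hβ1, hβ2⟩ := exists_between hu
  -- The hypersurface `r_* = c - (3/4) v` passes through the given point and meets `r_* = - v` at `v
  -- = α = -4c`. The slope exceeds `1/2`, for a definite energy, and is less than `1`, so that this
  -- meeting takes place at an earlier retarded time. The region is pinched at `α` and has no
  -- initial flux.
  set c := ρ + 3 / 4 * u with hc
  set α := -(4 * c) with hα
  have hαu : α < u := by rw [hα, hc]; linarith
  set p := lineR m c (3 / 4) with hp
  have hRp : R = p u := eq_lineR hm hR h3 (by rw [hc]; ring)
  have hpα : p α = lineR m 0 1 α := by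
    rw [hp, lineR, lineR]; congr 2; rw [hα]; ring
  have hlt : ∀ v, α < v → p v < lineR m 0 1 v := fun v hv =>
    lineR_lt_lineR hm (by rw [hα] at hv; linarith)
  have hle : ∀ v ∈ Icc α β, p v ≤ lineR m 0 1 v := fun v hv =>
    lineR_le_lineR hm (by have := hv.1; rw [hα] at this; linarith)
  have hpos : ∀ v, 0 < p v := fun v => lineR_pos hm _ _ _
  have hβu : β ≤ u₀ := hβ2.le.trans hL
  have hen := weighted_energy_le hm hfar hB (hαu.trans hβ1).le hβu (isRay_lineR hm c (3 / 4))
    (fun v _ => (hpos v).le) hle (fun v hv => hlt v hv.1)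
    (fun y hy => by rw [segmentDensity, ← hp, hpα]; simp)
  have hms : MeasurableSet (Ioo α β ×ˢ angles) := measurableSet_Ioo.prod measurableSet_angles
  have hzero : ∀ y ∈ Ioo α β ×ˢ angles,
      expWeight m y.1 * curveDensity m B 1 (lineR m 0 1) y = 0 := by
    rintro y ⟨hy, hya⟩
    have h := hdata y.1 (hy.2.trans hβ2) y.2.1 hya.1 y.2.2
    simp [curveDensity, fluxU, fluxR, h]
  rw [setIntegral_congr_fun hms (g := fun _ => 0) hzero, integral_zero, ← hp] at hen
  have hwc : ContinuousOn (fun y : ℝ × ℝ × ℝ => expWeight m y.1) (Icc α β ×ˢ univ) := by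
    rintro y ⟨hy, -⟩
    have := (hasDerivAt_expWeight m ((hy.2.trans hβu).trans_lt hfar.1).ne).continuousAt
    exact (this.comp' (f := fun y : ℝ × ℝ × ℝ => y.1) continuousAt_fst).continuousWithinAt
  have hpc : Continuous p := (isRay_lineR hm c (3 / 4)).differentiable.continuous
  have hcont : ContinuousOn (fun y => expWeight m y.1 * curveDensity m B (3 / 4) p y)
      (Icc α β ×ˢ univ) :=
    hwc.mul (continuousOn_curveDensity hm hB hβu hpc (fun v _ => (hpos v).le) hle)
  have hnn : ∀ y ∈ Ioo α β ×ˢ angles,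
      0 ≤ expWeight m y.1 * curveDensity m B (3 / 4) p y := by
    rintro y ⟨hy, hya⟩
    exact mul_nonneg (expWeight_pos m _).le (curveDensity_nonneg hfar (by norm_num)
      (hy.2.le.trans hβu) (hpos _).le (hlt _ hy.1).le hya)
  -- A continuous nonnegative density with zero integral vanishes at every point of the open strip,
  -- in particular at the given one.
  have hint0 := le_antisymm hen (setIntegral_nonneg hms hnn)
  rw [setIntegral_eq_zero_iff_of_nonneg_ae (ae_restrict_of_forall_mem hms hnn)
    (integrableOn_of_continuousOn_strip hcont)] at hint0
  have hopen : IsOpen (Ioo α β ×ˢ angles) := isOpen_Ioo.prod isOpen_angles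
  have heq := Measure.eqOn_open_of_ae_eq hint0 hopen
    (hcont.mono (prod_mono Ioo_subset_Icc_self (subset_univ _))) continuousOn_const
  have hmem : ((u, a) : ℝ × ℝ × ℝ) ∈ Ioo α β ×ˢ angles := ⟨⟨hαu, hβ1⟩, ha⟩
  have h0 := heq hmem
  simp only [Pi.zero_apply, mul_eq_zero, (expWeight_pos m u).ne', false_or, curveDensity,
    (sin_pos_of_mem_angles ha).ne', or_false] at h0
  have hb := hfar.2 u (hu.le.trans hL) R hR.le hR'.le
  rw [← hRp] at h0
  exact component_eq_zero_of_slope_flux (x := ![u, R, a.1, a.2]) (σ := 3 / 4) (by norm_num)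
    hb.1 hb.2 ((hu.trans_le hL).trans hfar.1).ne hR.ne' h0 j

/-- Null infinity and `{t = 0}` are reached by continuity in `R`. At `R = 0` the energy density no
longer controls `φ₀`, so the direct argument would not apply there. -/
theorem component_eq_zero_of_le {L : ℝ} (hm : 0 < m) (hfar : IsFar m u₀)
    (hB : IsMaxwellField m u₀ B) (hL : L ≤ u₀)
    (hdata : ∀ u < L, ∀ θ ∈ Ioo 0 Real.pi, ∀ φ : ℝ, ∀ j,
      component m B j ![u, lineR m 0 1 u, θ, φ] = 0)
    {u R : ℝ} {a : ℝ × ℝ} (hu : u < L) (hR : 0 ≤ R) (hR' : R ≤ lineR m 0 1 u) (ha : a ∈ angles)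
    (j : Fin 3) : component m B j ![u, R, a.1, a.2] = 0 := by
  have hpos := lineR_pos hm 0 1 u
  have hvec : Continuous fun r : ℝ => (![u, r, a.1, a.2] : Fin 4 → ℝ) := by
    refine continuous_pi fun i => ?_
    fin_cases i <;> simp <;> fun_prop
  have hc : ContinuousOn (fun r : ℝ => component m B j ![u, r, a.1, a.2])
      (Icc 0 (lineR m 0 1 u)) :=
    (continuousOn_component hB j).comp hvec.continuousOn
      fun r hr => mem_domain hm (hu.le.trans hL) hr.1 hr.2
  have heq : EqOn (fun r : ℝ => component m B j ![u, r, a.1, a.2]) (fun _ => 0)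
      (Ioo 0 (lineR m 0 1 u)) :=
    fun r hr => component_eq_zero_of_lt hm hfar hB hL hdata hu hr.1 hr.2 ha j
  exact heq.of_subset_closure hc continuousOn_const Ioo_subset_Icc_self
    (closure_Ioo hpos.ne).ge ⟨hR, hR'⟩

end

/-! The estimates on the hypersurfaces `H_s`. -/

/-- The slope `- dr_* / du` of `H_s`; for `s = 0`, where `R = 0`, any value would do. -/
noncomputable def hypSlope (s : ℝ) : ℝ := if s = 0 then 1 else 1 / s

/-- Slopes above `1/2` give a nonnegative energy density, and the value chosen at `s = 0` keeps null
infinity within this case. -/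
theorem one_le_hypSlope {s : ℝ} (h0 : 0 ≤ s) (h1 : s ≤ 1) : 1 ≤ hypSlope s := by
  rw [hypSlope]
  split_ifs with h
  · exact le_rfl
  · rw [le_div_iff₀ (lt_of_le_of_ne h0 (Ne.symm h))]
    linarith

/-- The constant `R = 0` solves `p' = σ F p²` for every `σ`, so null infinity needs no separate
treatment. -/
theorem isRay_hypR {m : ℝ} (hm : 0 < m) (s : ℝ) : IsRay m (hypSlope s) (hypR m s) := by
  by_cases hs : s = 0
  · intro u
    have h : hypR m s = fun _ => 0 := by ext v; simp [hypR, hs]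
    rw [h]
    simpa using hasDerivAt_const u (0 : ℝ)
  · rw [hypR_eq_lineR m hs, hypSlope, if_neg hs]
    exact isRay_lineR hm 0 (1 / s)

theorem hypR_nonneg {m : ℝ} (hm : 0 < m) (s u : ℝ) : 0 ≤ hypR m s u := by
  by_cases hs : s = 0
  · simp [hypR, hs]
  · rw [hypR_eq_lineR m hs]
    exact (lineR_pos hm _ _ _).le

theorem hypR_lt {m s u : ℝ} (hm : 0 < m) (h0 : 0 ≤ s) (h1 : s < 1) (hu : u < 0) :
    hypR m s u < lineR m 0 1 u := by
  by_cases hs : s = 0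
  · simpa [hypR, hs] using lineR_pos hm 0 1 u
  · rw [hypR_eq_lineR m hs]
    have hs' : 0 < s := lt_of_le_of_ne h0 (Ne.symm hs)
    refine lineR_lt_lineR hm ?_
    have : 1 < 1 / s := by rwa [lt_div_iff₀ hs', one_mul]
    nlinarith

theorem lapse_hypR_pos {m : ℝ} (hm : 0 < m) (s u : ℝ) : 0 < lapse m (hypR m s u) := by
  by_cases hs : s = 0
  · simp [hypR, hs, lapse]
  · rw [hypR_eq_lineR m hs, lapse]
    linarith [two_mul_lineR_lt hm 0 (1 / s) u]

theorem densityH_eq_curveDensity {m : ℝ} (hm : 0 < m) (s : ℝ) (B : BilinField) :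
    densityH m s B = curveDensity m B (hypSlope s) (hypR m s) := by
  ext y
  have hF := lapse_hypR_pos hm s y.1
  rw [densityH, curveDensity, currentU_eq_fluxU hF, currentR_eq_fluxR hF]
  congr 2
  by_cases hs : s = 0
  · simp [hs, hypR]
  · rw [if_neg hs, hypSlope, if_neg hs]
    ring

theorem densityH_one_eq {m : ℝ} (hm : 0 < m) (B : BilinField) :
    densityH m 1 B = curveDensity m B 1 (lineR m 0 1) := by
  rw [densityH_eq_curveDensity hm, hypR_one, hypSlope]
  simp

/-- Rescaling of an interval to `[0, 1]` in a product. -/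
theorem setIntegral_rescale {f : ℝ × ℝ × ℝ → ℝ} {a b : ℝ} (hab : a < b)
    (hf : IntegrableOn f (Ioo a b ×ˢ angles))
    (hf' : IntegrableOn (fun y : ℝ × ℝ × ℝ => (b - a) * f (a + y.1 * (b - a), y.2))
      (Ioo 0 1 ×ˢ angles)) :
    ∫ y in Ioo 0 1 ×ˢ angles, (b - a) * f (a + y.1 * (b - a), y.2) =
      ∫ y in Ioo a b ×ˢ angles, f y := by
  rw [Measure.volume_eq_prod] at hf hf' ⊢
  rw [setIntegral_prod _ hf, setIntegral_prod _ hf']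
  simp only [integral_const_mul]
  have h := intervalIntegral.mul_integral_comp_add_mul (a := 0) (b := 1)
    (f := fun r => ∫ z in angles, f (r, z)) (b - a) a
  rw [intervalIntegral.integral_of_le zero_le_one, intervalIntegral.integral_of_le (by linarith),
    integral_Ioc_eq_integral_Ioo, integral_Ioc_eq_integral_Ioo, mul_zero, mul_one, add_zero,
    add_sub_cancel] at h
  rw [← h]
  simp only [mul_comm (b - a)]

section

variable {m u₀ : ℝ} {B : BilinField}

theorem densityS_eq {u R : ℝ} {a : ℝ × ℝ} (hF : 0 < lapse m R) :
    densityS m u B (R, a) = Real.sin a.1 * fluxU m B ![u, R, a.1, a.2] := by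
  rw [densityS, currentU_eq_fluxU hF, mul_comm]

theorem continuousOn_densityS (hm : 0 < m) (hB : IsMaxwellField m u₀ B) :
    ContinuousOn (densityS m u₀ B) (Icc 0 (lineR m 0 1 u₀) ×ˢ univ) := by
  have hvec : Continuous fun y : ℝ × ℝ × ℝ => (![u₀, y.1, y.2.1, y.2.2] : Fin 4 → ℝ) := by
    refine continuous_pi fun i => ?_
    fin_cases i <;> simp <;> fun_prop
  have hmaps : MapsTo (fun y : ℝ × ℝ × ℝ => (![u₀, y.1, y.2.1, y.2.2] : Fin 4 → ℝ))
      (Icc 0 (lineR m 0 1 u₀) ×ˢ univ) {x | (x 0, x 1) ∈ domain m u₀} :=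
    fun y hy => mem_domain hm le_rfl hy.1.1 hy.1.2
  have hs : Continuous fun y : ℝ × ℝ × ℝ => Real.sin y.2.1 := by fun_prop
  refine (hs.continuousOn.mul ((continuousOn_fluxU hB).comp hvec.continuousOn hmaps)).congr ?_
  intro y hy
  exact densityS_eq (R := y.1) (lapse_pos_of_mem_domain (hmaps hy))

theorem integrableOn_densityS (hm : 0 < m) (hB : IsMaxwellField m u₀ B) (s : ℝ) :
    IntegrableOn (densityS m u₀ B) (paramS m u₀ s) := by
  rw [paramS, hypR_one]
  exact (integrableOn_of_continuousOn_strip (continuousOn_densityS hm hB)).mono_set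
    (prod_mono (Ioo_subset_Ioo_left (hypR_nonneg hm s u₀)) subset_rfl)

/-- This undoes the rescaling of `R` to `[0, 1]` that came with the parametrization by a box. -/
theorem integral_segmentDensity_eq_energyS (hm : 0 < m) (hB : IsMaxwellField m u₀ B)
    (hu₀ : u₀ < 0) {s : ℝ} (h0 : 0 ≤ s) (h1 : s < 1) :
    ∫ y in Ioo 0 1 ×ˢ angles, segmentDensity m B (hypR m s) (lineR m 0 1) u₀ y =
      energyS m u₀ s B := by
  have hlt := hypR_lt hm h0 h1 hu₀
  have hp := hypR_nonneg hm s u₀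
  have hint := integrableOn_densityS hm hB s
  rw [energyS]
  rw [paramS, hypR_one] at hint ⊢
  have hmap : MapsTo (fun y : ℝ × ℝ × ℝ =>
      (hypR m s u₀ + y.1 * (lineR m 0 1 u₀ - hypR m s u₀), y.2)) (Icc 0 1 ×ˢ univ)
      (Icc 0 (lineR m 0 1 u₀) ×ˢ univ) := by
    rintro y ⟨⟨hy0, hy1⟩, -⟩
    refine ⟨⟨?_, ?_⟩, mem_univ _⟩ <;> simp only <;> nlinarith
  rw [← setIntegral_rescale hlt hint]
  · refine setIntegral_congr_fun (measurableSet_Ioo.prod measurableSet_angles) ?_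
    intro y hy
    have := hmap ⟨Ioo_subset_Icc_self hy.1, mem_univ y.2⟩
    simp only
    rw [segmentDensity, densityS_eq]
    exact lapse_pos_of_mem_domain (mem_domain hm le_rfl this.1.1 this.1.2)
  · apply integrableOn_of_continuousOn_strip
    exact continuousOn_const.mul
      ((continuousOn_densityS hm hB).comp (by fun_prop) hmap)

/-- The energy on a hypersurface, when the field vanishes for `u < L`. -/
theorem integrableOn_curveDensity_and_integral_eq {L α σ : ℝ} {p : ℝ → ℝ} (hm : 0 < m)
    (hB : IsMaxwellField m u₀ B) (hα : α < L)
    (hvan : ∀ u < L, ∀ R, 0 ≤ R → R ≤ lineR m 0 1 u → ∀ a ∈ angles, ∀ j,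
      component m B j ![u, R, a.1, a.2] = 0)
    (hp : Continuous p) (hp0 : ∀ u ≤ u₀, 0 ≤ p u) (hpq : ∀ u ≤ u₀, p u ≤ lineR m 0 1 u) :
    IntegrableOn (curveDensity m B σ p) (paramH u₀) ∧
      ∫ y in paramH u₀, curveDensity m B σ p y =
        ∫ y in Ioo α u₀ ×ˢ angles, curveDensity m B σ p y := by
  have hsub : Ioo α u₀ ×ˢ angles ⊆ paramH u₀ := prod_mono Ioo_subset_Iio_self subset_rfl
  have hmeas : MeasurableSet (paramH u₀) := measurableSet_Iio.prod measurableSet_angles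
  have hint : IntegrableOn (curveDensity m B σ p) (Ioo α u₀ ×ˢ angles) :=
    integrableOn_of_continuousOn_strip (continuousOn_curveDensity hm hB le_rfl hp
      (fun u hu => hp0 u hu.2) (fun u hu => hpq u hu.2))
  have hz : ∀ y ∈ paramH u₀ \ (Ioo α u₀ ×ˢ angles), curveDensity m B σ p y = 0 := by
    rintro y ⟨⟨hy, hya⟩, hn⟩
    have hyα : y.1 ≤ α := by
      by_contra hc
      exact hn ⟨⟨not_le.1 hc, hy⟩, hya⟩
    have hyu : y.1 ≤ u₀ := le_of_lt hy
    have h := hvan y.1 (hyα.trans_lt hα) (p y.1) (hp0 _ hyu) (hpq _ hyu) y.2 hya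
    simp [curveDensity, fluxU, fluxR, h]
  exact ⟨hint.of_forall_sdiff_eq_zero hmeas hz,
    setIntegral_eq_of_subset_of_forall_sdiff_eq_zero hmeas hsub hz⟩

theorem energy_estimates (hm : 0 < m) (hfar : IsFar m u₀) (hB : IsMaxwellField m u₀ B)
    (hdata : DataSupportedAwayFromI0 m u₀ B) {s : ℝ} (h0 : 0 ≤ s) (h1 : s < 1) :
    IntegrableOn (densityH m s B) (paramH u₀) ∧ IntegrableOn (densityH m 1 B) (paramH u₀) ∧
      energyH m u₀ s B ≤ (expWeight m u₀)⁻¹ * energyH m u₀ 1 B ∧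
      energyH m u₀ 1 B ≤ energyH m u₀ s B + energyS m u₀ s B ∧
      0 ≤ energyH m u₀ s B + energyS m u₀ s B := by
  obtain ⟨L, hL, hini⟩ := component_eq_zero_on_initial hdata
  have hvan : ∀ u < L, ∀ R, 0 ≤ R → R ≤ lineR m 0 1 u → ∀ a ∈ angles, ∀ j,
      component m B j ![u, R, a.1, a.2] = 0 :=
    fun u hu R hR hR' a ha j => component_eq_zero_of_le hm hfar hB hL hini hu hR hR' ha j
  -- The field vanishes for `u < L`, so cutting at any `α < L` neither changes the energies nor
  -- creates a flux through `{u = α}`.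
  obtain ⟨α, hα⟩ := exists_lt L
  have hαu : α ≤ u₀ := hα.le.trans hL
  have hray := isRay_hypR hm s
  have hp0 := hypR_nonneg hm s
  have hlt : ∀ u ≤ u₀, hypR m s u < lineR m 0 1 u :=
    fun u hu => hypR_lt hm h0 h1 (hu.trans_lt hfar.1)
  have hσ := one_le_hypSlope h0 h1.le
  obtain ⟨is, es⟩ := integrableOn_curveDensity_and_integral_eq (σ := hypSlope s) hm hB hα hvan
    hray.differentiable.continuous (fun u _ => hp0 u) (fun u hu => (hlt u hu).le)
  obtain ⟨i1, e1⟩ := integrableOn_curveDensity_and_integral_eq (σ := 1) hm hB hα hvan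
    (isRay_lineR hm 0 1).differentiable.continuous (fun u _ => (lineR_pos hm 0 1 u).le)
    (fun u _ => le_rfl)
  rw [← densityH_eq_curveDensity hm] at is es
  rw [← densityH_one_eq hm] at i1 e1
  have hsub : Ioo α u₀ ×ˢ angles ⊆ paramH u₀ := prod_mono Ioo_subset_Iio_self subset_rfl
  have hms : MeasurableSet (Ioo α u₀ ×ˢ angles) := measurableSet_Ioo.prod measurableSet_angles
  have hms1 : MeasurableSet (Ioo (0 : ℝ) 1 ×ˢ angles) :=
    measurableSet_Ioo.prod measurableSet_angles
  have hsegα : ∀ y ∈ Ioo (0 : ℝ) 1 ×ˢ angles,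
      segmentDensity m B (hypR m s) (lineR m 0 1) α y = 0 := by
    rintro y ⟨⟨hy0, hy1⟩, hya⟩
    have hl := hlt α hαu
    have h := hvan α hα (hypR m s α + y.1 * (lineR m 0 1 α - hypR m s α))
      (by nlinarith [hp0 α]) (by nlinarith) y.2 hya
    simp [segmentDensity, fluxU, h]
  have ns : ∀ y ∈ Ioo α u₀ ×ˢ angles, 0 ≤ densityH m s B y := by
    rintro y ⟨hy, hya⟩
    rw [densityH_eq_curveDensity hm]
    exact curveDensity_nonneg hfar (by linarith) hy.2.le (hp0 _) (hlt _ hy.2.le).le hya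
  have n1 : ∀ y ∈ Ioo α u₀ ×ˢ angles, 0 ≤ densityH m 1 B y := by
    rintro y ⟨hy, hya⟩
    rw [densityH_one_eq hm]
    exact curveDensity_nonneg hfar (by norm_num) hy.2.le (lineR_pos hm 0 1 _).le le_rfl hya
  have hwc : ContinuousOn (fun y : ℝ × ℝ × ℝ => expWeight m y.1) (Icc α u₀ ×ˢ univ) := by
    rintro y ⟨hy, -⟩
    have := (hasDerivAt_expWeight m (hy.2.trans_lt hfar.1).ne).continuousAt
    exact (this.comp' (f := fun y : ℝ × ℝ × ℝ => y.1) continuousAt_fst).continuousWithinAt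
  have iws : IntegrableOn (fun y => expWeight m y.1 * densityH m s B y) (Ioo α u₀ ×ˢ angles) := by
    rw [densityH_eq_curveDensity hm]
    exact integrableOn_of_continuousOn_strip (hwc.mul (continuousOn_curveDensity hm hB le_rfl
      hray.differentiable.continuous (fun u _ => hp0 u) (fun u hu => (hlt u hu.2).le)))
  have iw1 : IntegrableOn (fun y => expWeight m y.1 * densityH m 1 B y) (Ioo α u₀ ×ˢ angles) := by
    rw [densityH_one_eq hm]
    exact integrableOn_of_continuousOn_strip (hwc.mul (continuousOn_curveDensity hm hB le_rfl
      (isRay_lineR hm 0 1).differentiable.continuous (fun u _ => (lineR_pos hm 0 1 u).le)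
      (fun u _ => le_rfl)))
  have hS0 : 0 ≤ energyS m u₀ s B := by
    rw [← integral_segmentDensity_eq_energyS hm hB hfar.1 h0 h1]
    exact setIntegral_nonneg hms1 fun y hy =>
      segmentDensity_nonneg hfar le_rfl (hp0 _) (hlt _ le_rfl).le le_rfl hy
  refine ⟨is, i1, ?_, ?_, ?_⟩
  · have h := weighted_energy_le hm hfar hB hαu le_rfl hray (fun u _ => hp0 u)
      (fun u hu => (hlt u hu.2).le) (fun u hu => hlt u hu.2.le) hsegα
    rw [← densityH_eq_curveDensity hm, ← densityH_one_eq hm] at h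
    -- For negative `u` the weight is decreasing and at most `1`. It is bounded below by its value
    -- at `u₀` on `H_s` and above by `1` on `H_1`.
    have ha : ∫ y in Ioo α u₀ ×ˢ angles, expWeight m u₀ * densityH m s B y ≤
        ∫ y in Ioo α u₀ ×ˢ angles, expWeight m y.1 * densityH m s B y := by
      refine setIntegral_mono_on ((is.mono_set hsub).const_mul _) iws hms ?_
      rintro y hy
      refine mul_le_mul_of_nonneg_right (Real.exp_le_exp.2 ?_) (ns y hy)
      have hy1 : y.1 < u₀ := hy.1.2
      rw [← neg_le_neg_iff, ← div_neg, ← div_neg]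
      exact div_le_div_of_nonneg_left (by positivity) (neg_pos.2 hfar.1) (neg_le_neg hy1.le)
    have hb : ∫ y in Ioo α u₀ ×ˢ angles, expWeight m y.1 * densityH m 1 B y ≤
        ∫ y in Ioo α u₀ ×ˢ angles, densityH m 1 B y := by
      refine setIntegral_mono_on iw1 (i1.mono_set hsub) hms ?_
      rintro y hy
      refine mul_le_of_le_one_left (n1 y hy) (Real.exp_le_one_iff.2 ?_)
      exact div_nonpos_of_nonneg_of_nonpos (by positivity) ((hy.1.2.trans hfar.1).le)
    rw [integral_const_mul] at ha
    rw [energyH, energyH, es, e1, inv_mul_eq_div, le_div_iff₀' (expWeight_pos m u₀)]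
    linarith
  · have key := energy_identity (w := fun _ => 1) (w' := fun _ => 0) hm hB hαu le_rfl
      (fun u _ => hasDerivAt_const u 1) continuousOn_const hray (fun u _ => hp0 u)
      (fun u hu => (hlt u hu.2).le) (fun u hu => hlt u hu.2.le)
    simp only [one_mul] at key
    rw [setIntegral_congr_fun hms1 (g := fun _ => 0) hsegα, integral_zero, sub_zero,
      integral_segmentDensity_eq_energyS hm hB hfar.1 h0 h1,
      ← densityH_eq_curveDensity hm, ← densityH_one_eq hm, ← es, ← e1] at key
    have h2 : 0 ≤ ∫ x in graphBox α u₀, (lineR m 0 1 (x 0) - hypR m s (x 0)) *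
        weightedError m B (fun _ => 1) (fun _ => 0) (graphMap (hypR m s) (lineR m 0 1) x) := by
      refine setIntegral_nonneg measurableSet_Icc fun x hx => ?_
      obtain ⟨g0, g1, g2, -⟩ :=
        graphMap_mem_graphRegion (fun u hu => (hlt u hu.2).le) hx
      have h := hfar.2 _ g0.2 _ ((hp0 _).trans g1.1) g1.2
      exact mul_nonneg (sub_nonneg.2 (hlt _ g0.2).le)
        (weightedError_one_nonneg hm h.1 h.2 (Real.sin_nonneg_of_mem_Icc g2))
    rw [key] at h2
    rw [energyH, energyH]
    linarith
  · refine add_nonneg ?_ hS0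
    rw [energyH, es]
    exact setIntegral_nonneg hms ns

end

end MaxwellPeeling

/-! ### The theorem. -/

theorem proposition1 (m : ℝ) (hm : 0 < m) :
    ∃ U : ℝ, U < 0 ∧ ∀ u₀ : ℝ, u₀ ≤ U →
      ∃ C : ℝ, 0 < C ∧ ∀ B : MaxwellPeeling.BilinField,
        MaxwellPeeling.IsMaxwellField m u₀ B →
        MaxwellPeeling.DataSupportedAwayFromI0 m u₀ B →
        ∀ s : ℝ, 0 ≤ s → s < 1 →
          IntegrableOn (MaxwellPeeling.densityH m s B) (MaxwellPeeling.paramH u₀) ∧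
          IntegrableOn (MaxwellPeeling.densityH m 1 B) (MaxwellPeeling.paramH u₀) ∧
          IntegrableOn (MaxwellPeeling.densityS m u₀ B) (MaxwellPeeling.paramS m u₀ s) ∧
          MaxwellPeeling.energyH m u₀ s B ≤ C * MaxwellPeeling.energyH m u₀ 1 B ∧
          MaxwellPeeling.energyH m u₀ 1 B ≤
            C * (MaxwellPeeling.energyH m u₀ s B + MaxwellPeeling.energyS m u₀ s B) := by
  obtain ⟨U, hU, hfar⟩ := MaxwellPeeling.exists_far hm
  refine ⟨U, hU, fun u₀ hu₀ => ⟨(MaxwellPeeling.expWeight m u₀)⁻¹,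
    inv_pos.2 (MaxwellPeeling.expWeight_pos m u₀), fun B hB hdata s h0 h1 => ?_⟩⟩
  have hf : MaxwellPeeling.IsFar m u₀ :=
    ⟨hu₀.trans_lt hU, fun u hu => hfar u (hu.trans hu₀)⟩
  obtain ⟨is, i1, hs, h1s, hnn⟩ := MaxwellPeeling.energy_estimates hm hf hB hdata h0 h1
  refine ⟨is, i1, MaxwellPeeling.integrableOn_densityS hm hB s, hs, h1s.trans ?_⟩
  -- The reverse estimate holds with constant `1`. It survives enlarging the constant to `exp (-160
  -- m / u₀) ≥ 1` because its right side is nonnegative.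
  refine le_mul_of_one_le_left hnn ((one_le_inv₀ (MaxwellPeeling.expWeight_pos m u₀)).2 ?_)
  exact Real.exp_le_one_iff.2 (div_nonpos_of_nonneg_of_nonpos (by positivity) hf.1.le)
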